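/- Let $l_{12}, l_{13}, l_{23}\ge 1$ be integers and let $Q$ be the quiver with nodes $1,2,3$ having $l_{ij}$ arrows from node $j$ to node $i$ for $i<j$ and no other arrows. (For a bundle $V=L_1\oplus L_2\oplus L_3$ split into line bundles on a Calabi–Yau threefold, $l_{ij}=\dim\mathrm{Ext}^1(L_j,L_i)$.) Let $c_1(L_1),c_1(L_2),c_1(L_3)\in\mathbb Z^h$ satisfy $c_1(L_1)+c_1(L_2)+c_1(L_3)=0$ and suppose that $c_1(L_2)=r\,c_1(L_3)$ for some real $r>0$. Let $D_{abc}$ be real numbers (the triple intersection numbers) and $t^a$ real numbers (the Kähler parameters), $1\le a,b,c\le h$, and let the FI parameters be, up to a common positive factor $\kappa$, the slopes of the summands: $$\zeta_v=\kappa\sum_{a,b,c}D_{abc}\,c_1(L_v)^a\,t^b\,t^c,\qquad v=1,2,3 .$$ A complex representation $S$ of $Q$ of dimension vector $(1,1,1)$ is called stable if every subrepresentation $R$ other than $0$ and $S$ satisfies $$\frac{\sum_v\zeta_v\dim R_v}{\sum_v\dim R_v}<\frac{\sum_v\zeta_v\dim S_v}{\sum_v\dim S_v}.$$ Let $\mathcal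 M$ be the moduli space of stable representations of dimension vector $(1,1,1)$, that is, the space of stable representations modulo $(\mathbb C^*)^3=\prod_v GL_1(\mathbb C)$, with the quotient of the Euclidean topology. Then all rational homology groups $H_i(\mathcal M;\mathbb Q)$ are finite-dimensional, only finitely many are nonzero, and the Poincaré polynomial $P(t)=\sum_i\dim H_i(\mathcal M;\mathbb Q)\,t^i$ is $$P(t)=\begin{cases}\dfrac{(t^{2(l_{13}+l_{23})}-1)(t^{2l_{12}}-1)}{(t^2-1)^2}, & \text{if }\zeta_1<0 \text{ and } \zeta_3>0,\\[2mm] 0, & \text{otherwise.}\end{cases}$$ -/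

import Mathlib

open scoped Matrix

/-! ## Quiver representations, stability, moduli -/

section Quivers

variable {V : Type} [Fintype V]

/-- Complex representations, with dimension vector `d`, of the quiver with vertex set `V` and
adjacency matrix `l`, where `l i j` is the number of arrows from `j` to `i`. To each arrow
`j → i` is assigned a linear map `ℂ ^ d j → ℂ ^ d i`. The topology is the product topology. -/
abbrev QuiverRep (l : Matrix V V ℕ) (d : V → ℕ) : Type :=
  ∀ i j : V, Fin (l i j) → Matrix (Fin (d i)) (Fin (d j)) ℂ

/-- A family of subspaces is a subrepresentation if every arrow maps it into itself. -/
def IsSubrep {l : Matrix V V ℕ} {d : V → ℕ} (f : QuiverRep l d)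
    (U : ∀ v, Submodule ℂ (Fin (d v) → ℂ)) : Prop :=
  ∀ i j (a : Fin (l i j)), ∀ x ∈ U j, f i j a *ᵥ x ∈ U i

/-- The slope `(∑ ζ_v e_v) / (∑ e_v)` of a dimension vector `e`. -/
noncomputable def quiverSlope (ζ : V → ℝ) (e : V → ℕ) : ℝ :=
  (∑ v, ζ v * e v) / (∑ v, (e v : ℝ))

/-- A representation is stable if it is nonzero and every proper (nonzero, not the whole)
subrepresentation has strictly smaller slope. -/
def IsStableRep {l : Matrix V V ℕ} {d : V → ℕ} (ζ : V → ℝ) (f : QuiverRep l d) : Prop :=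
  d ≠ 0 ∧ ∀ U : ∀ v, Submodule ℂ (Fin (d v) → ℂ), IsSubrep f U → U ≠ ⊥ → U ≠ ⊤ →
    quiverSlope ζ (fun v => Module.finrank ℂ (U v)) < quiverSlope ζ d

/-- Two stable representations are equivalent if they lie in one orbit of `∏ GL(d_v, ℂ)`, acting
by `(g • f)_a = g_{head a} f_a g_{tail a}⁻¹`. -/
def stableRepSetoid (l : Matrix V V ℕ) (d : V → ℕ) (ζ : V → ℝ) :
    Setoid {f : QuiverRep l d // IsStableRep ζ f} where
  r f f' := ∃ g : ∀ v, GL (Fin (d v)) ℂ, ∀ i j (a : Fin (l i j)),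
    f'.1 i j a = (g i : Matrix (Fin (d i)) (Fin (d i)) ℂ) * f.1 i j a *
      ((g j)⁻¹ : GL (Fin (d j)) ℂ).val
  iseqv :=
    { refl := fun f => ⟨fun _ => 1, fun i j a => by simp⟩
      symm := by
        rintro f f' ⟨g, hg⟩
        refine ⟨fun v => (g v)⁻¹, fun i j a => ?_⟩
        rw [hg i j a, inv_inv]
        simp only [Matrix.mul_assoc]
        rw [← Units.val_mul, inv_mul_cancel, Units.val_one, Matrix.mul_one, ← Matrix.mul_assoc,
          ← Units.val_mul, inv_mul_cancel, Units.val_one, Matrix.one_mul]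
      trans := by
        rintro f f' f'' ⟨g, hg⟩ ⟨g', hg'⟩
        refine ⟨fun v => g' v * g v, fun i j a => ?_⟩
        rw [hg' i j a, hg i j a, mul_inv_rev, Units.val_mul, Units.val_mul]
        simp only [Matrix.mul_assoc] }

/-- The moduli space of stable representations: the stable locus modulo `∏ GL(d_v, ℂ)`, with the
quotient of the usual (Euclidean) topology. -/
def StableModuli (l : Matrix V V ℕ) (d : V → ℕ) (ζ : V → ℝ) : Type :=
  Quotient (stableRepSetoid l d ζ)

instance (l : Matrix V V ℕ) (d : V → ℕ) (ζ : V → ℝ) : TopologicalSpace (StableModuli l d ζ) :=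
  inferInstanceAs (TopologicalSpace (Quotient (stableRepSetoid l d ζ)))

end Quivers

/-! ## Betti numbers -/

/-- The `i`-th singular homology of a space, with rational coefficients. -/
noncomputable abbrev rationalHomology (M : Type) [TopologicalSpace M] (i : ℕ) : ModuleCat.{0} ℚ :=
  ((AlgebraicTopology.singularHomologyFunctor (ModuleCat.{0} ℚ) i).obj (ModuleCat.of ℚ ℚ)).obj
    (TopCat.of M)

/-- `P` is the Poincaré polynomial of `M`: all rational homology groups are finite-dimensional and
the coefficient of `t ^ i` in `P` is the `i`-th Betti number. -/
def IsPoincarePolynomial (M : Type) [TopologicalSpace M] (P : Polynomial ℤ) : Prop :=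
  ∀ i : ℕ, Module.Finite ℚ (rationalHomology M i) ∧
    P.coeff i = (Module.finrank ℚ (rationalHomology M i) : ℤ)

/-! ## The slope of a line bundle -/

/-- The slope `∑ D_{ijk} c^i t^j t^k` of a line bundle with first Chern class `c`, with respect to
the Kähler parameters `t` and the triple intersection numbers `D`. -/
noncomputable def lineBundleSlope {h : ℕ} (D : Fin h → Fin h → Fin h → ℝ) (t : Fin h → ℝ)
    (c : Fin h → ℤ) : ℝ :=
  ∑ i, ∑ j, ∑ k, D i j k * c i * t j * t k

/-! ## Barycentric subdivision of tuples -/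

section FaceBoundary

variable {X Y : ℕ → Type}

/-- The alternating sum of the linear extensions of face maps. -/
noncomputable def faceBoundary (δ : ∀ n, Fin (n + 1) → X (n + 1) → X n) (n : ℕ) :
    (X (n + 1) →₀ ℚ) →ₗ[ℚ] (X n →₀ ℚ) :=
  ∑ i : Fin (n + 1), ((-1 : ℚ) ^ (i : ℕ)) • Finsupp.lmapDomain ℚ ℚ (δ n i)

lemma faceBoundary_single (δ : ∀ n, Fin (n + 1) → X (n + 1) → X n) (n : ℕ) (x : X (n + 1)) :
    faceBoundary δ n (Finsupp.single x 1) =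
      ∑ i : Fin (n + 1), ((-1 : ℚ) ^ (i : ℕ)) • Finsupp.single (δ n i x) 1 := by
  simp [faceBoundary, LinearMap.sum_apply, Finsupp.lmapDomain_apply]

lemma faceBoundary_comp_lmapDomain (δ : ∀ n, Fin (n + 1) → X (n + 1) → X n)
    (δ' : ∀ n, Fin (n + 1) → Y (n + 1) → Y n) (φ : ∀ n, X n → Y n)
    (h : ∀ n i x, δ' n i (φ (n + 1) x) = φ n (δ n i x)) (n : ℕ) (c : X (n + 1) →₀ ℚ) :
    faceBoundary δ' n (Finsupp.lmapDomain ℚ ℚ (φ (n + 1)) c) =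
      Finsupp.lmapDomain ℚ ℚ (φ n) (faceBoundary δ n c) := by
  suffices H : faceBoundary δ' n ∘ₗ Finsupp.lmapDomain ℚ ℚ (φ (n + 1)) =
      Finsupp.lmapDomain ℚ ℚ (φ n) ∘ₗ faceBoundary δ n from congrArg (fun f => f c) H
  refine Finsupp.lhom_ext' fun x => LinearMap.ext_ring ?_
  simp [faceBoundary_single, Finsupp.lmapDomain_apply, h, Finsupp.mapDomain_single,
    -Finsupp.smul_single]

end FaceBoundary

section TupleChain

variable {K K' : Type}

/-- Formal rational combinations of `n`-tuples. -/
abbrev TupleChain (K : Type) (n : ℕ) : Type := (Fin n → K) →₀ ℚ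

namespace TupleChain

/-- The simplicial boundary, lowering the number of vertices by one. -/
noncomputable abbrev boundary (K : Type) (n : ℕ) : TupleChain K (n + 1) →ₗ[ℚ] TupleChain K n :=
  faceBoundary (X := fun n => Fin n → K) (fun _ i w => w ∘ i.succAbove) n

/-- Adjoining a new initial vertex. -/
noncomputable def cone (b : K) (n : ℕ) : TupleChain K n →ₗ[ℚ] TupleChain K (n + 1) :=
  Finsupp.lmapDomain ℚ ℚ (fun w => (Fin.cons b w : Fin (n + 1) → K))

lemma cone_single (b : K) (n : ℕ) (w : Fin n → K) :
    cone b n (Finsupp.single w 1) = Finsupp.single (Fin.cons b w : Fin (n + 1) → K) 1 := by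
  simp [cone, Finsupp.lmapDomain_apply]

lemma boundary_cone_zero (b : K) (c : TupleChain K 0) : boundary K 0 (cone b 0 c) = c := by
  suffices H : boundary K 0 ∘ₗ cone b 0 = LinearMap.id from congrArg (fun f => f c) H
  refine Finsupp.lhom_ext' fun x => LinearMap.ext_ring ?_
  simp only [LinearMap.comp_apply, Finsupp.lsingle_apply, cone_single, faceBoundary_single,
    LinearMap.id_apply]
  simp [Subsingleton.elim _ x]

lemma boundary_cone (b : K) (n : ℕ) (c : TupleChain K (n + 1)) :
    boundary K (n + 1) (cone b (n + 1) c) = c - cone b n (boundary K n c) := by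
  suffices H : boundary K (n + 1) ∘ₗ cone b (n + 1) =
      LinearMap.id - cone b n ∘ₗ boundary K n from congrArg (fun f => f c) H
  refine Finsupp.lhom_ext' fun w => LinearMap.ext_ring ?_
  simp only [LinearMap.comp_apply, Finsupp.lsingle_apply, cone_single, faceBoundary_single,
    LinearMap.id_apply, LinearMap.sub_apply, map_sum, map_smul]
  rw [Fin.sum_univ_succ, sub_eq_add_neg, ← Finset.sum_neg_distrib]
  congr 1
  · simp only [Fin.val_zero, pow_zero, one_smul]
    congr 1
  · refine Finset.sum_congr rfl fun i _ => ?_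
    rw [Fin.val_succ, pow_succ, mul_neg_one, neg_smul]
    congr 3
    funext j
    refine Fin.cases ?_ (fun j => ?_) j <;> simp

lemma boundary_boundary : ∀ (n : ℕ) (c : TupleChain K (n + 2)),
    boundary K n (boundary K (n + 1) c) = 0 := by
  intro n
  induction n with
  | zero =>
    intro c
    suffices H : boundary K 0 ∘ₗ boundary K 1 = 0 from congrArg (fun f => f c) H
    refine Finsupp.lhom_ext' fun w => LinearMap.ext_ring ?_
    have hw : w = Fin.cons (w 0) (Fin.tail w) := (Fin.cons_self_tail w).symm
    rw [hw]
    simp only [LinearMap.comp_apply, Finsupp.lsingle_apply, ← cone_single, LinearMap.zero_apply]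
    rw [boundary_cone, map_sub, boundary_cone_zero, sub_self]
  | succ n ih =>
    intro c
    suffices H : boundary K (n + 1) ∘ₗ boundary K (n + 2) = 0 from congrArg (fun f => f c) H
    refine Finsupp.lhom_ext' fun w => LinearMap.ext_ring ?_
    have hw : w = Fin.cons (w 0) (Fin.tail w) := (Fin.cons_self_tail w).symm
    rw [hw]
    simp only [LinearMap.comp_apply, Finsupp.lsingle_apply, ← cone_single, LinearMap.zero_apply]
    rw [boundary_cone, map_sub, boundary_cone, ih, map_zero, sub_zero, sub_self]

variable (β : ∀ n, (Fin (n + 1) → K) → K)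

/-- Subdivision of tuples with respect to a choice of an interior vertex of each tuple. -/
noncomputable def subdiv : ∀ n, TupleChain K n →ₗ[ℚ] TupleChain K n
  | 0 => LinearMap.id
  | n + 1 => Finsupp.linearCombination ℚ fun w =>
      cone (β n w) n (subdiv n (boundary K n (Finsupp.single w 1)))

/-- The chain homotopy from the identity to the subdivision. -/
noncomputable def subdivHomotopy : ∀ n, TupleChain K n →ₗ[ℚ] TupleChain K (n + 1)
  | 0 => 0
  | n + 1 => Finsupp.linearCombination ℚ fun w => cone (β n w) (n + 1)
      (Finsupp.single w 1 - subdivHomotopy n (boundary K n (Finsupp.single w 1)))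

lemma subdiv_succ_single (n : ℕ) (w : Fin (n + 1) → K) :
    subdiv β (n + 1) (Finsupp.single w 1) =
      cone (β n w) n (subdiv β n (boundary K n (Finsupp.single w 1))) := by
  simp [subdiv, Finsupp.linearCombination_single]

lemma subdivHomotopy_succ_single (n : ℕ) (w : Fin (n + 1) → K) :
    subdivHomotopy β (n + 1) (Finsupp.single w 1) = cone (β n w) (n + 1)
      (Finsupp.single w 1 - subdivHomotopy β n (boundary K n (Finsupp.single w 1))) := by
  simp [subdivHomotopy, Finsupp.linearCombination_single]

lemma boundary_subdivHomotopy : ∀ (n : ℕ) (c : TupleChain K (n + 1)),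
    boundary K (n + 1) (subdivHomotopy β (n + 1) c) + subdivHomotopy β n (boundary K n c) =
      c - subdiv β (n + 1) c := by
  intro n
  induction n with
  | zero =>
    intro c
    suffices H : boundary K 1 ∘ₗ subdivHomotopy β 1 + subdivHomotopy β 0 ∘ₗ boundary K 0 =
      LinearMap.id - subdiv β 1 from congrArg (fun f => f c) H
    refine Finsupp.lhom_ext' fun w => LinearMap.ext_ring ?_
    simp only [LinearMap.comp_apply, Finsupp.lsingle_apply, LinearMap.add_apply,
      LinearMap.sub_apply, LinearMap.id_apply]
    rw [subdivHomotopy_succ_single, boundary_cone, subdiv_succ_single]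
    simp [subdivHomotopy, subdiv]
  | succ n ih =>
    intro c
    suffices H : boundary K (n + 2) ∘ₗ subdivHomotopy β (n + 2) +
        subdivHomotopy β (n + 1) ∘ₗ boundary K (n + 1) =
      LinearMap.id - subdiv β (n + 2) from congrArg (fun f => f c) H
    refine Finsupp.lhom_ext' fun w => LinearMap.ext_ring ?_
    simp only [LinearMap.comp_apply, Finsupp.lsingle_apply, LinearMap.add_apply,
      LinearMap.sub_apply, LinearMap.id_apply]
    rw [subdivHomotopy_succ_single, boundary_cone, subdiv_succ_single]
    have h := ih (boundary K (n + 1) (Finsupp.single w 1))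
    rw [boundary_boundary, map_zero, add_zero] at h
    rw [map_sub (boundary K (n + 1)), h]
    abel_nf

/-- Applying a map to every vertex. -/
noncomputable abbrev map (φ : K → K') (n : ℕ) : TupleChain K n →ₗ[ℚ] TupleChain K' n :=
  Finsupp.lmapDomain ℚ ℚ (fun w => φ ∘ w)

lemma map_single (φ : K → K') (n : ℕ) (w : Fin n → K) :
    map φ n (Finsupp.single w 1) = Finsupp.single (φ ∘ w) 1 := by
  simp [Finsupp.lmapDomain_apply]

lemma map_boundary (φ : K → K') (n : ℕ) (c : TupleChain K (n + 1)) :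
    boundary K' n (map φ (n + 1) c) = map φ n (boundary K n c) :=
  faceBoundary_comp_lmapDomain _ _ (fun n (w : Fin n → K) => φ ∘ w) (fun _ _ _ => rfl) n c

lemma map_cone (φ : K → K') (b : K) (n : ℕ) (c : TupleChain K n) :
    map φ (n + 1) (cone b n c) = cone (φ b) n (map φ n c) := by
  suffices H : map φ (n + 1) ∘ₗ cone b n = cone (φ b) n ∘ₗ map φ n from
    congrArg (fun f => f c) H
  refine Finsupp.lhom_ext' fun w => LinearMap.ext_ring ?_
  simp only [LinearMap.comp_apply, Finsupp.lsingle_apply, cone_single, map_single]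
  congr 1
  funext j
  refine Fin.cases ?_ (fun j => ?_) j <;> simp

/-- A map commuting with the choices of interior vertices commutes with subdivision. -/
lemma subdiv_map {β' : ∀ n, (Fin (n + 1) → K') → K'} (φ : K → K')
    (h : ∀ n w, β' n (φ ∘ w) = φ (β n w)) : ∀ (n : ℕ) (c : TupleChain K n),
    subdiv β' n (map φ n c) = map φ n (subdiv β n c) := by
  intro n
  induction n with
  | zero => intro c; rfl
  | succ n ih =>
    intro c
    suffices H : subdiv β' (n + 1) ∘ₗ map φ (n + 1) = map φ (n + 1) ∘ₗ subdiv β (n + 1) from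
      congrArg (fun f => f c) H
    refine Finsupp.lhom_ext' fun w => LinearMap.ext_ring ?_
    simp only [LinearMap.comp_apply, Finsupp.lsingle_apply]
    rw [map_single, subdiv_succ_single, subdiv_succ_single, ← map_single, map_boundary, ih, h,
      map_cone]

/-- A map commuting with the choices of interior vertices commutes with the homotopy. -/
lemma subdivHomotopy_map {β' : ∀ n, (Fin (n + 1) → K') → K'} (φ : K → K')
    (h : ∀ n w, β' n (φ ∘ w) = φ (β n w)) : ∀ (n : ℕ) (c : TupleChain K n),
    subdivHomotopy β' n (map φ n c) = map φ (n + 1) (subdivHomotopy β n c) := by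
  intro n
  induction n with
  | zero => intro c; exact (map_zero (map φ 1)).symm
  | succ n ih =>
    intro c
    suffices H : subdivHomotopy β' (n + 1) ∘ₗ map φ (n + 1) =
        map φ (n + 2) ∘ₗ subdivHomotopy β (n + 1) from congrArg (fun f => f c) H
    refine Finsupp.lhom_ext' fun w => LinearMap.ext_ring ?_
    simp only [LinearMap.comp_apply, Finsupp.lsingle_apply]
    rw [map_single, subdivHomotopy_succ_single, subdivHomotopy_succ_single, ← map_single,
      map_boundary, ih, h, map_cone]
    simp only [map_sub]

end TupleChain

end TupleChain

lemma Finsupp.map_mem_supported {α β : Type} {s : Set α} {t : Set β}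
    (f : (α →₀ ℚ) →ₗ[ℚ] (β →₀ ℚ))
    (h : ∀ a ∈ s, f (Finsupp.single a 1) ∈ Finsupp.supported ℚ ℚ t)
    {c : α →₀ ℚ} (hc : c ∈ Finsupp.supported ℚ ℚ s) : f c ∈ Finsupp.supported ℚ ℚ t := by
  rw [Finsupp.supported_eq_span_single] at hc
  induction hc using Submodule.span_induction with
  | mem x hx => obtain ⟨a, ha, rfl⟩ := hx; exact h a ha
  | zero => simp
  | add x y _ _ hx hy => rw [map_add]; exact add_mem hx hy
  | smul q x _ hx => rw [map_smul]; exact Submodule.smul_mem _ _ hx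

namespace TupleChain

section Mesh

variable {E : Type} [NormedAddCommGroup E] [NormedSpace ℝ E]

/-- The barycenter of a nonempty tuple. -/
noncomputable def baryc (n : ℕ) (w : Fin (n + 1) → E) : E := ((n : ℝ) + 1)⁻¹ • ∑ i, w i

lemma dist_baryc_le (n : ℕ) (w : Fin (n + 1) → E) (x : E) :
    dist x (baryc n w) ≤ ((n : ℝ) + 1)⁻¹ * ∑ i, dist x (w i) := by
  have hn : ((n : ℝ) + 1) ≠ 0 := by positivity
  have : x - baryc n w = ((n : ℝ) + 1)⁻¹ • ∑ i, (x - w i) := by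
    rw [Finset.sum_sub_distrib, smul_sub, baryc]
    congr 1
    simp only [Finset.sum_const, Finset.card_univ, Fintype.card_fin]
    rw [← Nat.cast_smul_eq_nsmul ℝ, smul_smul]
    push_cast
    rw [inv_mul_cancel₀ hn, one_smul]
  rw [dist_eq_norm, this, norm_smul, norm_inv, Real.norm_of_nonneg (by positivity)]
  gcongr
  refine (norm_sum_le _ _).trans (le_of_eq ?_)
  simp [dist_eq_norm]

lemma dist_baryc_le_of_forall (n : ℕ) (w : Fin (n + 1) → E) (x : E) (M : ℝ)
    (h : ∀ j, dist x (w j) ≤ M) : dist x (baryc n w) ≤ M := by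
  refine (dist_baryc_le n w x).trans ?_
  have := Finset.sum_le_sum fun i (_ : i ∈ Finset.univ) => h i
  rw [inv_mul_le_iff₀ (by positivity)]
  simpa using this

lemma dist_vertex_baryc_le (n N : ℕ) (hn : n + 1 ≤ N) (w : Fin (n + 1) → E) (D : ℝ)
    (h : ∀ i j, dist (w i) (w j) ≤ D) (k : Fin (n + 1)) :
    dist (w k) (baryc n w) ≤ (1 - (N : ℝ)⁻¹) * D := by
  have hD : 0 ≤ D := by simpa using h k k
  refine (dist_baryc_le n w (w k)).trans ?_
  have h1 : ∑ i, dist (w k) (w i) ≤ n * D := by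
    rw [← Finset.add_sum_erase _ _ (Finset.mem_univ k), dist_self, zero_add]
    refine (Finset.sum_le_sum fun i _ => h k i).trans ?_
    simp [Finset.card_erase_of_mem]
  have hN : (N : ℝ)⁻¹ ≤ ((n : ℝ) + 1)⁻¹ := by
    apply inv_anti₀ (by positivity)
    exact_mod_cast hn
  calc ((n : ℝ) + 1)⁻¹ * ∑ i, dist (w k) (w i) ≤ ((n : ℝ) + 1)⁻¹ * (n * D) := by gcongr
    _ = (1 - ((n : ℝ) + 1)⁻¹) * D := by field_simp; ring
    _ ≤ _ := by gcongr

/-- Subdividing a tuple with at most `N` vertices stays in all balls containing the vertices,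
and shrinks the mesh by the factor `1 - 1 / N`. -/
lemma subdiv_single_mem_supported (N : ℕ) : ∀ (n : ℕ) (_ : n ≤ N) (w : Fin n → E),
    subdiv baryc n (Finsupp.single w 1) ∈ Finsupp.supported ℚ ℚ {w' : Fin n → E |
      (∀ x M, (∀ j, dist x (w j) ≤ M) → ∀ j, dist x (w' j) ≤ M) ∧
      ∀ D, (∀ i j, dist (w i) (w j) ≤ D) → ∀ i j, dist (w' i) (w' j) ≤ (1 - (N : ℝ)⁻¹) * D} := by
  intro n
  induction n with
  | zero =>
    intro _ w
    exact Finsupp.single_mem_supported ℚ _ ⟨fun _ _ _ j => j.elim0, fun _ _ i => i.elim0⟩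
  | succ n ih =>
    intro hn w
    rw [subdiv_succ_single]
    have h1 : boundary E n (Finsupp.single w 1) ∈
        Finsupp.supported ℚ ℚ (Set.range fun i : Fin (n + 1) => w ∘ i.succAbove) := by
      rw [faceBoundary_single]
      exact sum_mem fun i _ => Submodule.smul_mem _ _ (Finsupp.single_mem_supported ℚ _ ⟨i, rfl⟩)
    have h2 := Finsupp.map_mem_supported (t := {w' : Fin n → E |
      (∀ x M, (∀ j, dist x (w j) ≤ M) → ∀ j, dist x (w' j) ≤ M) ∧
      ∀ D, (∀ i j, dist (w i) (w j) ≤ D) → ∀ i j, dist (w' i) (w' j) ≤ (1 - (N : ℝ)⁻¹) * D})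
      (subdiv baryc n) (by
        rintro _ ⟨i, rfl⟩
        refine Finsupp.supported_mono ?_ (ih (by omega) (w ∘ i.succAbove))
        rintro w' ⟨hw1, hw2⟩
        exact ⟨fun x M h => hw1 x M fun j => h _, fun D h => hw2 D fun i j => h _ _⟩) h1
    refine Finsupp.map_mem_supported _ ?_ h2
    rintro w' ⟨hw1, hw2⟩
    rw [cone_single]
    refine Finsupp.single_mem_supported ℚ _ ⟨fun x M h j => ?_, fun D h => ?_⟩
    · refine Fin.cases ?_ (fun j => ?_) j
      · exact dist_baryc_le_of_forall n w x M h
      · exact hw1 x M h j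
    · have hb : ∀ j, dist (baryc n w) (w' j) ≤ (1 - (N : ℝ)⁻¹) * D :=
        hw1 _ _ fun j => by rw [dist_comm]; exact dist_vertex_baryc_le n N hn w D h j
      have h0 : 0 ≤ (1 - (N : ℝ)⁻¹) * D :=
        dist_nonneg.trans (dist_vertex_baryc_le n N hn w D h 0)
      intro i j
      refine Fin.cases ?_ (fun i => ?_) i <;> refine Fin.cases ?_ (fun j => ?_) j
      · simpa using h0
      · simpa using hb j
      · simpa [dist_comm] using hb i
      · simpa using hw2 D h i j

lemma iterate_subdiv_single_mem_supported (n : ℕ) (w : Fin n → E) (D : ℝ)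
    (h : ∀ i j, dist (w i) (w j) ≤ D) (k : ℕ) :
    (subdiv baryc n ^ k) (Finsupp.single w 1) ∈ Finsupp.supported ℚ ℚ
      {w' : Fin n → E | ∀ i j, dist (w' i) (w' j) ≤ (1 - (n : ℝ)⁻¹) ^ k * D} := by
  induction k with
  | zero => exact Finsupp.single_mem_supported ℚ _ (by simpa using h)
  | succ k ih =>
    have hk : (subdiv baryc n ^ (k + 1)) (Finsupp.single w 1) =
        subdiv baryc n ((subdiv baryc n ^ k) (Finsupp.single w 1)) := by
      rw [pow_succ']
      rfl
    rw [hk]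
    refine Finsupp.map_mem_supported _ (fun w' hw' => ?_) ih
    refine Finsupp.supported_mono ?_ (subdiv_single_mem_supported n n le_rfl w')
    rintro w'' ⟨-, h2⟩ i j
    rw [pow_succ', mul_assoc]
    exact h2 _ hw' i j

end Mesh

end TupleChain

/-! ## Subdivision of singular chains -/

section AffineSimplex

/-- The affine map of standard simplices with prescribed values on the vertices. -/
noncomputable def affineSimplex {n m : ℕ} (w : Fin n → stdSimplex ℝ (Fin m)) :
    C(stdSimplex ℝ (Fin n), stdSimplex ℝ (Fin m)) where
  toFun t := ⟨∑ i, (t : Fin n → ℝ) i • (w i : Fin m → ℝ),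
    (convex_stdSimplex ℝ (Fin m)).sum_mem (fun i _ => t.2.1 i) t.2.2 fun i _ => (w i).2⟩
  continuous_toFun := by
    refine Continuous.subtype_mk ?_ _
    refine continuous_finsetSum _ fun i _ => ?_
    exact ((continuous_apply i).comp continuous_subtype_val).smul continuous_const

lemma affineSimplex_coe {n m : ℕ} (w : Fin n → stdSimplex ℝ (Fin m)) (t : stdSimplex ℝ (Fin n)) :
    (affineSimplex w t : Fin m → ℝ) = ∑ i, (t : Fin n → ℝ) i • (w i : Fin m → ℝ) := rfl

/-- The map of standard simplices induced by a map of vertices. -/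
noncomputable def simplexMap {n m : ℕ} (f : Fin n → Fin m) :
    C(stdSimplex ℝ (Fin n), stdSimplex ℝ (Fin m)) :=
  ⟨stdSimplex.map f, stdSimplex.continuous_map f⟩

lemma affineSimplex_comp_simplexMap {k n m : ℕ} (w : Fin n → stdSimplex ℝ (Fin m))
    (f : Fin k → Fin n) :
    (affineSimplex w).comp (simplexMap f) = affineSimplex (w ∘ f) := by
  ext t j
  change (affineSimplex w (stdSimplex.map f t) : Fin m → ℝ) j =
    (affineSimplex (w ∘ f) t : Fin m → ℝ) j
  rw [affineSimplex_coe, affineSimplex_coe]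
  have h : ∀ i, ((stdSimplex.map f t : stdSimplex ℝ (Fin n)) : Fin n → ℝ) i =
      ∑ a with f a = i, (t : Fin k → ℝ) a := fun i =>
    FunOnFinite.linearMap_apply_apply ℝ ℝ f _ i
  simp only [Finset.sum_apply, Pi.smul_apply, h, smul_eq_mul, Finset.sum_mul, Function.comp]
  rw [← Finset.sum_fiberwise Finset.univ f
    (fun a => (t : Fin k → ℝ) a * (w (f a) : Fin m → ℝ) j)]
  refine Finset.sum_congr rfl fun i _ => Finset.sum_congr rfl fun a ha => ?_
  rw [(Finset.mem_filter.1 ha).2]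

lemma affineSimplex_comp {k n m : ℕ} (w : Fin n → stdSimplex ℝ (Fin m))
    (v : Fin k → stdSimplex ℝ (Fin n)) :
    (affineSimplex w).comp (affineSimplex v) = affineSimplex (affineSimplex w ∘ v) := by
  ext t j
  change (affineSimplex w (affineSimplex v t) : Fin m → ℝ) j =
    (affineSimplex (affineSimplex w ∘ v) t : Fin m → ℝ) j
  simp only [affineSimplex_coe, Finset.sum_apply, Pi.smul_apply, smul_eq_mul, Function.comp,
    Finset.sum_mul, Finset.mul_sum, mul_assoc]
  exact Finset.sum_comm

lemma affineSimplex_vertex {n m : ℕ} (w : Fin n → stdSimplex ℝ (Fin m)) :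
    affineSimplex w ∘ stdSimplex.vertex = w := by
  funext i
  ext j
  change (affineSimplex w (stdSimplex.vertex i) : Fin m → ℝ) j = (w i : Fin m → ℝ) j
  rw [affineSimplex_coe, Finset.sum_apply, Finset.sum_eq_single i]
  · simp
  · intro b _ hb
    simp [Pi.single_eq_of_ne hb]
  · simp

lemma affineSimplex_id (n : ℕ) :
    affineSimplex (stdSimplex.vertex : Fin n → stdSimplex ℝ (Fin n)) = ContinuousMap.id _ := by
  ext t j
  change (affineSimplex stdSimplex.vertex t : Fin n → ℝ) j = (t : Fin n → ℝ) j
  rw [affineSimplex_coe]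
  simp [Finset.sum_apply, Pi.single_apply]

/-- The barycenter of a nonempty tuple of points of a standard simplex. -/
noncomputable def simplexBaryc (m n : ℕ) (w : Fin (n + 1) → stdSimplex ℝ (Fin m)) :
    stdSimplex ℝ (Fin m) :=
  ⟨TupleChain.baryc n fun i => (w i : Fin m → ℝ), by
    rw [TupleChain.baryc, Finset.smul_sum]
    refine (convex_stdSimplex ℝ (Fin m)).sum_mem (fun i _ => by positivity) ?_ fun i _ => (w i).2
    simp only [Finset.sum_const, Finset.card_univ, Fintype.card_fin, nsmul_eq_mul]
    push_cast
    field_simp⟩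

lemma simplexBaryc_comp_affineSimplex {m m' : ℕ} (v : Fin m → stdSimplex ℝ (Fin m')) (n : ℕ)
    (w : Fin (n + 1) → stdSimplex ℝ (Fin m)) :
    simplexBaryc m' n (affineSimplex v ∘ w) = affineSimplex v (simplexBaryc m n w) := by
  ext j
  change TupleChain.baryc n (fun i => (affineSimplex v (w i) : Fin m' → ℝ)) j =
    (affineSimplex v (simplexBaryc m n w) : Fin m' → ℝ) j
  have h : (simplexBaryc m n w : Fin m → ℝ) = TupleChain.baryc n fun i => (w i : Fin m → ℝ) := rfl
  simp only [affineSimplex_coe, h, TupleChain.baryc, Finset.sum_apply, Pi.smul_apply, smul_eq_mul,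
    Finset.mul_sum, Finset.sum_mul, mul_assoc]
  exact Finset.sum_comm

end AffineSimplex

section SingularChain

variable (X : Type) [TopologicalSpace X]

/-- Rational singular chains on simplices with `n` vertices. -/
abbrev SingularChain (n : ℕ) : Type := C(stdSimplex ℝ (Fin n), X) →₀ ℚ

namespace SingularChain

/-- The faces of a singular simplex. -/
noncomputable abbrev face {X : Type} [TopologicalSpace X] (n : ℕ) (i : Fin (n + 1))
    (σ : C(stdSimplex ℝ (Fin (n + 1)), X)) : C(stdSimplex ℝ (Fin n), X) :=
  σ.comp (simplexMap i.succAbove)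

/-- The singular boundary, lowering the number of vertices by one. -/
noncomputable abbrev boundary (n : ℕ) : SingularChain X (n + 1) →ₗ[ℚ] SingularChain X n :=
  faceBoundary (X := fun n => C(stdSimplex ℝ (Fin n), X)) (fun n i σ => face n i σ) n

variable {X}

/-- The singular chain obtained by composing a singular simplex with affine simplices. -/
noncomputable def ofTuples {m : ℕ} (σ : C(stdSimplex ℝ (Fin m), X)) (n : ℕ) :
    TupleChain (stdSimplex ℝ (Fin m)) n →ₗ[ℚ] SingularChain X n :=
  Finsupp.lmapDomain ℚ ℚ fun w => σ.comp (affineSimplex w)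

lemma ofTuples_single {m : ℕ} (σ : C(stdSimplex ℝ (Fin m), X)) (n : ℕ)
    (w : Fin n → stdSimplex ℝ (Fin m)) :
    ofTuples σ n (Finsupp.single w 1) = Finsupp.single (σ.comp (affineSimplex w)) 1 := by
  simp [ofTuples, Finsupp.lmapDomain_apply]

lemma ofTuples_vertex {m : ℕ} (σ : C(stdSimplex ℝ (Fin m), X)) :
    ofTuples σ m (Finsupp.single stdSimplex.vertex 1) = Finsupp.single σ 1 := by
  rw [ofTuples_single, affineSimplex_id, ContinuousMap.comp_id]

lemma boundary_ofTuples {m : ℕ} (σ : C(stdSimplex ℝ (Fin m), X)) (n : ℕ)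
    (c : TupleChain (stdSimplex ℝ (Fin m)) (n + 1)) :
    boundary X n (ofTuples σ (n + 1) c) = ofTuples σ n (TupleChain.boundary _ n c) := by
  refine faceBoundary_comp_lmapDomain _ _
    (fun n (w : Fin n → stdSimplex ℝ (Fin m)) => σ.comp (affineSimplex w)) (fun n i w => ?_) n c
  change (σ.comp (affineSimplex w)).comp (simplexMap i.succAbove) = _
  rw [ContinuousMap.comp_assoc, affineSimplex_comp_simplexMap]

lemma ofTuples_map {m k : ℕ} (σ : C(stdSimplex ℝ (Fin m), X))
    (w : Fin k → stdSimplex ℝ (Fin m)) (n : ℕ) (c : TupleChain (stdSimplex ℝ (Fin k)) n) :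
    ofTuples (σ.comp (affineSimplex w)) n c =
      ofTuples σ n (TupleChain.map (affineSimplex w) n c) := by
  suffices H : ofTuples (σ.comp (affineSimplex w)) n =
      ofTuples σ n ∘ₗ TupleChain.map (affineSimplex w) n from congrArg (fun f => f c) H
  refine Finsupp.lhom_ext' fun v => LinearMap.ext_ring ?_
  simp only [LinearMap.comp_apply, Finsupp.lsingle_apply, TupleChain.map_single, ofTuples_single]
  rw [ContinuousMap.comp_assoc, affineSimplex_comp]

lemma ofTuples_mem_supported {m : ℕ} (σ : C(stdSimplex ℝ (Fin m), X)) (n : ℕ)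
    (c : TupleChain (stdSimplex ℝ (Fin m)) n) :
    ofTuples σ n c ∈ Finsupp.supported ℚ ℚ
      {τ : C(stdSimplex ℝ (Fin n), X) | Set.range τ ⊆ Set.range σ} := by
  refine Finsupp.map_mem_supported (s := Set.univ) _ (fun w _ => ?_) (by simp)
  rw [ofTuples_single]
  refine Finsupp.single_mem_supported ℚ _ ?_
  rintro _ ⟨t, rfl⟩
  exact ⟨_, rfl⟩

/-- Barycentric subdivision of singular chains. -/
noncomputable def subdiv (n : ℕ) : SingularChain X n →ₗ[ℚ] SingularChain X n :=
  Finsupp.linearCombination ℚ fun σ => ofTuples σ n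
    (TupleChain.subdiv (simplexBaryc n) n (Finsupp.single stdSimplex.vertex 1))

/-- The natural chain homotopy from the identity to barycentric subdivision. -/
noncomputable def subdivHomotopy (n : ℕ) : SingularChain X n →ₗ[ℚ] SingularChain X (n + 1) :=
  Finsupp.linearCombination ℚ fun σ => ofTuples σ (n + 1)
    (TupleChain.subdivHomotopy (simplexBaryc n) n (Finsupp.single stdSimplex.vertex 1))

lemma subdiv_ofTuples {m : ℕ} (σ : C(stdSimplex ℝ (Fin m), X)) (n : ℕ)
    (c : TupleChain (stdSimplex ℝ (Fin m)) n) :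
    subdiv n (ofTuples σ n c) = ofTuples σ n (TupleChain.subdiv (simplexBaryc m) n c) := by
  suffices H : subdiv n ∘ₗ ofTuples σ n =
      ofTuples σ n ∘ₗ TupleChain.subdiv (simplexBaryc m) n from congrArg (fun f => f c) H
  refine Finsupp.lhom_ext' fun w => LinearMap.ext_ring ?_
  simp only [LinearMap.comp_apply, Finsupp.lsingle_apply, ofTuples_single]
  rw [subdiv, Finsupp.linearCombination_single, one_smul, ofTuples_map,
    ← TupleChain.subdiv_map (simplexBaryc n) (affineSimplex w)
      (simplexBaryc_comp_affineSimplex w),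
    TupleChain.map_single, affineSimplex_vertex]

lemma subdivHomotopy_ofTuples {m : ℕ} (σ : C(stdSimplex ℝ (Fin m), X)) (n : ℕ)
    (c : TupleChain (stdSimplex ℝ (Fin m)) n) :
    subdivHomotopy n (ofTuples σ n c) =
      ofTuples σ (n + 1) (TupleChain.subdivHomotopy (simplexBaryc m) n c) := by
  suffices H : subdivHomotopy n ∘ₗ ofTuples σ n =
      ofTuples σ (n + 1) ∘ₗ TupleChain.subdivHomotopy (simplexBaryc m) n from
    congrArg (fun f => f c) H
  refine Finsupp.lhom_ext' fun w => LinearMap.ext_ring ?_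
  simp only [LinearMap.comp_apply, Finsupp.lsingle_apply, ofTuples_single]
  rw [subdivHomotopy, Finsupp.linearCombination_single, one_smul, ofTuples_map,
    ← TupleChain.subdivHomotopy_map (simplexBaryc n) (affineSimplex w)
      (simplexBaryc_comp_affineSimplex w),
    TupleChain.map_single, affineSimplex_vertex]

lemma boundary_subdivHomotopy (n : ℕ) (c : SingularChain X (n + 1)) :
    boundary X (n + 1) (subdivHomotopy (n + 1) c) + subdivHomotopy n (boundary X n c) =
      c - subdiv (n + 1) c := by
  suffices H : boundary X (n + 1) ∘ₗ subdivHomotopy (n + 1) + subdivHomotopy n ∘ₗ boundary X n =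
      LinearMap.id - subdiv (n + 1) from congrArg (fun f => f c) H
  refine Finsupp.lhom_ext' fun σ => LinearMap.ext_ring ?_
  simp only [LinearMap.comp_apply, Finsupp.lsingle_apply, LinearMap.add_apply,
    LinearMap.sub_apply, LinearMap.id_apply]
  rw [← ofTuples_vertex σ]
  rw [subdivHomotopy_ofTuples, boundary_ofTuples, boundary_ofTuples, subdivHomotopy_ofTuples,
    subdiv_ofTuples, ← map_add, TupleChain.boundary_subdivHomotopy, map_sub]

lemma boundary_boundary (n : ℕ) (c : SingularChain X (n + 2)) :
    boundary X n (boundary X (n + 1) c) = 0 := by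
  suffices H : boundary X n ∘ₗ boundary X (n + 1) = 0 from congrArg (fun f => f c) H
  refine Finsupp.lhom_ext' fun σ => LinearMap.ext_ring ?_
  simp only [LinearMap.comp_apply, Finsupp.lsingle_apply, LinearMap.zero_apply]
  rw [← ofTuples_vertex σ, boundary_ofTuples, boundary_ofTuples, TupleChain.boundary_boundary,
    map_zero]

/-- Chains whose simplices each lie in one of two given subsets. -/
noncomputable abbrev small (U V : Set X) (n : ℕ) : Submodule ℚ (SingularChain X n) :=
  Finsupp.supported ℚ ℚ {σ : C(stdSimplex ℝ (Fin n), X) | Set.range σ ⊆ U ∨ Set.range σ ⊆ V}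

lemma ofTuples_mem_small {U V : Set X} {m : ℕ} {σ : C(stdSimplex ℝ (Fin m), X)}
    (hσ : Set.range σ ⊆ U ∨ Set.range σ ⊆ V) (n : ℕ)
    (c : TupleChain (stdSimplex ℝ (Fin m)) n) : ofTuples σ n c ∈ small U V n :=
  Finsupp.supported_mono (fun _ hτ => hσ.imp hτ.trans hτ.trans) (ofTuples_mem_supported σ n c)

lemma subdiv_mem_small {U V : Set X} (n : ℕ) {c : SingularChain X n} (hc : c ∈ small U V n) :
    subdiv n c ∈ small U V n :=
  Finsupp.map_mem_supported _ (fun σ hσ => by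
    rw [← ofTuples_vertex σ, subdiv_ofTuples]
    exact ofTuples_mem_small hσ n _) hc

lemma subdivHomotopy_mem_small {U V : Set X} (n : ℕ) {c : SingularChain X n}
    (hc : c ∈ small U V n) : subdivHomotopy n c ∈ small U V (n + 1) :=
  Finsupp.map_mem_supported _ (fun σ hσ => by
    rw [← ofTuples_vertex σ, subdivHomotopy_ofTuples]
    exact ofTuples_mem_small hσ _ _) hc

lemma boundary_mem_small {U V : Set X} (n : ℕ) {c : SingularChain X (n + 1)}
    (hc : c ∈ small U V (n + 1)) : boundary X n c ∈ small U V n :=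
  Finsupp.map_mem_supported _ (fun σ hσ => by
    rw [← ofTuples_vertex σ, boundary_ofTuples]
    exact ofTuples_mem_small hσ _ _) hc

lemma iterate_subdiv_mem_small {U V : Set X} (n k : ℕ) {c : SingularChain X n}
    (hc : c ∈ small U V n) : (subdiv n)^[k] c ∈ small U V n := by
  induction k with
  | zero => exact hc
  | succ k ih => rw [Function.iterate_succ_apply']; exact subdiv_mem_small n ih

lemma iterate_subdiv_ofTuples {m : ℕ} (σ : C(stdSimplex ℝ (Fin m), X)) (n k : ℕ)
    (c : TupleChain (stdSimplex ℝ (Fin m)) n) :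
    (subdiv n)^[k] (ofTuples σ n c) =
      ofTuples σ n ((TupleChain.subdiv (simplexBaryc m) n)^[k] c) := by
  induction k with
  | zero => rfl
  | succ k ih => rw [Function.iterate_succ_apply', Function.iterate_succ_apply', ih,
      subdiv_ofTuples]

lemma dist_affineSimplex_le {n m : ℕ} (w : Fin n → stdSimplex ℝ (Fin m)) (D : ℝ)
    (h : ∀ i j, dist (w i) (w j) ≤ D) (k : Fin n) (t : stdSimplex ℝ (Fin n)) :
    dist (affineSimplex w t) (w k) ≤ D := by
  have : affineSimplex w t ∈ Subtype.val ⁻¹' Metric.closedBall (w k : Fin m → ℝ) D :=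
    (convex_closedBall (w k : Fin m → ℝ) D).sum_mem (fun i _ => t.2.1 i) t.2.2
      fun i _ => h i k
  exact this

lemma iterate_tuple_subdiv_mem_supported (m n : ℕ) (w : Fin n → stdSimplex ℝ (Fin m)) (D : ℝ)
    (h : ∀ i j, dist (w i) (w j) ≤ D) (k : ℕ) :
    (TupleChain.subdiv (simplexBaryc m) n)^[k] (Finsupp.single w 1) ∈ Finsupp.supported ℚ ℚ
      {w' : Fin n → stdSimplex ℝ (Fin m) |
        ∀ i j, dist (w' i) (w' j) ≤ (1 - (n : ℝ)⁻¹) ^ k * D} := by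
  set ι : stdSimplex ℝ (Fin m) → (Fin m → ℝ) := Subtype.val
  have hmap : ∀ c, TupleChain.map ι n ((TupleChain.subdiv (simplexBaryc m) n)^[k] c) =
      (TupleChain.subdiv TupleChain.baryc n ^ k) (TupleChain.map ι n c) := by
    intro c
    rw [Module.End.coe_pow]
    induction k with
    | zero => rfl
    | succ k ih => rw [Function.iterate_succ_apply', Function.iterate_succ_apply', ← ih,
        TupleChain.subdiv_map (simplexBaryc m) ι fun _ _ => rfl]
  have h1 := TupleChain.iterate_subdiv_single_mem_supported n (ι ∘ w) D (fun i j => h i j) k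
  rw [← TupleChain.map_single, ← hmap] at h1
  rw [Finsupp.mem_supported] at h1 ⊢
  intro w' hw'
  refine h1 (a := ι ∘ w') ?_
  have hinj : Function.Injective fun w : Fin n → stdSimplex ℝ (Fin m) => ι ∘ w :=
    Subtype.val_injective.comp_left
  rw [Finset.mem_coe, Finsupp.mem_support_iff, Finsupp.lmapDomain_apply,
    Finsupp.mapDomain_apply hinj]
  exact Finsupp.mem_support_iff.1 hw'

lemma exists_iterate_subdiv_single_mem_small {U V : Set X} (hU : IsOpen U) (hV : IsOpen V)
    (hUV : U ∪ V = Set.univ) (n : ℕ) (σ : C(stdSimplex ℝ (Fin n), X)) :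
    ∃ k, (subdiv n)^[k] (Finsupp.single σ 1) ∈ small U V n := by
  obtain ⟨δ, hδ, hball⟩ := lebesgue_number_lemma_of_metric
    (s := (Set.univ : Set (stdSimplex ℝ (Fin n)))) (c := fun b : Bool => σ ⁻¹' (cond b U V))
    isCompact_univ (by
      rintro (_ | _)
      · exact hV.preimage σ.continuous
      · exact hU.preimage σ.continuous) (by
      intro t _
      have : σ t ∈ U ∪ V := hUV ▸ Set.mem_univ _
      rw [Set.mem_iUnion]
      exact this.elim (fun h => ⟨true, h⟩) fun h => ⟨false, h⟩)
  obtain ⟨D, hD⟩ : ∃ D, ∀ i j : Fin n, dist (stdSimplex.vertex i : stdSimplex ℝ (Fin n))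
      (stdSimplex.vertex j) ≤ D := by
    obtain ⟨D, hD⟩ := (Set.finite_range fun p : Fin n × Fin n =>
      dist (stdSimplex.vertex p.1 : stdSimplex ℝ (Fin n)) (stdSimplex.vertex p.2)).bddAbove
    exact ⟨D, fun i j => hD ⟨(i, j), rfl⟩⟩
  obtain ⟨k, hk⟩ : ∃ k : ℕ, 0 < n → (1 - (n : ℝ)⁻¹) ^ k * D < δ := by
    rcases Nat.eq_zero_or_pos n with rfl | hn
    · exact ⟨0, fun h => absurd h (lt_irrefl _)⟩
    · have h1 : (n : ℝ)⁻¹ ≤ 1 := inv_le_one_of_one_le₀ (by exact_mod_cast hn)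
      have h2 : 0 < (n : ℝ)⁻¹ := by positivity
      have := (tendsto_pow_atTop_nhds_zero_of_lt_one (r := 1 - (n : ℝ)⁻¹)
        (by linarith) (by linarith)).mul_const D
      rw [zero_mul] at this
      obtain ⟨k, hk⟩ := (this.eventually (gt_mem_nhds hδ)).exists
      exact ⟨k, fun _ => hk⟩
  refine ⟨k, ?_⟩
  rw [← ofTuples_vertex σ, iterate_subdiv_ofTuples]
  refine Finsupp.map_mem_supported _ (fun w hw => ?_)
    (iterate_tuple_subdiv_mem_supported n n _ D hD k)
  rw [ofTuples_single]
  refine Finsupp.single_mem_supported ℚ _ ?_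
  rcases Nat.eq_zero_or_pos n with rfl | hn
  · left
    rintro _ ⟨t, rfl⟩
    exact absurd t.2.2 (by simp)
  · obtain ⟨b, hb⟩ := hball (w ⟨0, hn⟩) trivial
    have : Set.range (σ.comp (affineSimplex w)) ⊆ cond b U V := by
      rintro _ ⟨t, rfl⟩
      exact hb ((dist_affineSimplex_le w _ hw ⟨0, hn⟩ t).trans_lt (hk hn))
    cases b
    · exact Or.inr this
    · exact Or.inl this

lemma exists_iterate_subdiv_mem_small {U V : Set X} (hU : IsOpen U) (hV : IsOpen V)
    (hUV : U ∪ V = Set.univ) (n : ℕ) (c : SingularChain X n) :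
    ∃ k, (subdiv n)^[k] c ∈ small U V n := by
  induction c using Finsupp.induction_linear with
  | zero => exact ⟨0, zero_mem _⟩
  | add f g hf hg =>
    obtain ⟨k, hk⟩ := hf
    obtain ⟨l, hl⟩ := hg
    refine ⟨k + l, ?_⟩
    rw [iterate_map_add]
    refine add_mem ?_ ?_
    · rw [add_comm, Function.iterate_add_apply]
      exact iterate_subdiv_mem_small n l hk
    · rw [Function.iterate_add_apply]
      exact iterate_subdiv_mem_small n k hl
  | single σ q =>
    obtain ⟨k, hk⟩ := exists_iterate_subdiv_single_mem_small hU hV hUV n σ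
    refine ⟨k, ?_⟩
    have : (Finsupp.single σ q : SingularChain X n) = q • Finsupp.single σ 1 := by simp
    rw [this, ← Module.End.coe_pow, map_smul, Module.End.coe_pow]
    exact Submodule.smul_mem _ _ hk

/-- A chain with small boundary is small up to a boundary. -/
theorem exists_sub_boundary_mem_small {U V : Set X} (hU : IsOpen U) (hV : IsOpen V)
    (hUV : U ∪ V = Set.univ) (n : ℕ) (c : SingularChain X (n + 1))
    (hc : boundary X n c ∈ small U V n) :
    ∃ e : SingularChain X (n + 2), c - boundary X (n + 1) e ∈ small U V (n + 1) := by
  obtain ⟨k, hk⟩ := exists_iterate_subdiv_mem_small hU hV hUV (n + 1) c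
  induction k generalizing c with
  | zero => exact ⟨0, by simpa using hk⟩
  | succ k ih =>
    have h := boundary_subdivHomotopy n c
    have hT : subdivHomotopy n (boundary X n c) ∈ small U V (n + 1) :=
      subdivHomotopy_mem_small n hc
    obtain ⟨e, he⟩ := ih (subdiv (n + 1) c) (by
      rw [show subdiv (n + 1) c = c - boundary X (n + 1) (subdivHomotopy (n + 1) c) -
        subdivHomotopy n (boundary X n c) by rw [sub_sub, h, sub_sub_cancel], map_sub, map_sub,
        boundary_boundary, sub_zero]
      exact sub_mem hc (boundary_mem_small n hT)) hk
    refine ⟨e + subdivHomotopy (n + 1) c, ?_⟩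
    have : c - boundary X (n + 1) (e + subdivHomotopy (n + 1) c) =
        subdiv (n + 1) c - boundary X (n + 1) e + subdivHomotopy n (boundary X n c) := by
      rw [map_add, eq_sub_iff_add_eq.2 h]
      abel
    rw [this]
    exact add_mem he hT

end SingularChain

end SingularChain

/-! ## The Mayer-Vietoris sequence -/

section Homology

open CategoryTheory Limits AlgebraicTopology

section ModuleComplex

variable {M N P : ℕ → Type} [∀ n, AddCommGroup (M n)] [∀ n, Module ℚ (M n)]
  [∀ n, AddCommGroup (N n)] [∀ n, Module ℚ (N n)] [∀ n, AddCommGroup (P n)] [∀ n, Module ℚ (P n)]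

/-- The chain complex built from a sequence of linear maps with vanishing composites. -/
noncomputable def moduleComplex (d : ∀ n, M (n + 1) →ₗ[ℚ] M n)
    (hd : ∀ n x, d n (d (n + 1) x) = 0) : ChainComplex (ModuleCat.{0} ℚ) ℕ :=
  ChainComplex.of (fun n => ModuleCat.of ℚ (M n)) (fun n => ModuleCat.ofHom (d n))
    (fun n => ModuleCat.hom_ext (LinearMap.ext (hd n)))

variable {d : ∀ n, M (n + 1) →ₗ[ℚ] M n} {hd : ∀ n x, d n (d (n + 1) x) = 0}
  {e : ∀ n, N (n + 1) →ₗ[ℚ] N n} {he : ∀ n x, e n (e (n + 1) x) = 0}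
  {b : ∀ n, P (n + 1) →ₗ[ℚ] P n} {hb : ∀ n x, b n (b (n + 1) x) = 0}

lemma moduleComplex_d (n : ℕ) : (moduleComplex d hd).d (n + 1) n = ModuleCat.ofHom (d n) :=
  ChainComplex.of_d (fun n => ModuleCat.of ℚ (M n)) (fun n => ModuleCat.ofHom (d n)) n

variable (hd he) in
/-- The chain map given by a sequence of linear maps commuting with the differentials. -/
noncomputable def moduleComplexMap (f : ∀ n, M n →ₗ[ℚ] N n)
    (hf : ∀ n x, e n (f (n + 1) x) = f n (d n x)) :
    moduleComplex d hd ⟶ moduleComplex e he :=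
  ChainComplex.ofHom (fun n => ModuleCat.ofHom (f n)) fun n => by
    rw [moduleComplex_d, moduleComplex_d]
    exact ModuleCat.hom_ext (LinearMap.ext (hf n))

lemma moduleComplex_exactAt (h0 : ∀ x, ∃ y, d 0 y = x)
    (h : ∀ n x, d n x = 0 → ∃ y, d (n + 1) y = x) (n : ℕ) :
    (moduleComplex d hd).ExactAt n := by
  cases n with
  | zero =>
    rw [HomologicalComplex.exactAt_iff' _ 1 0 0 (by simp) (by simp),
      ShortComplex.moduleCat_exact_iff]
    intro x _
    obtain ⟨y, hy⟩ := h0 x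
    refine ⟨y, ?_⟩
    change (moduleComplex d hd).d 1 0 y = x
    rw [moduleComplex_d]
    exact hy
  | succ n =>
    rw [HomologicalComplex.exactAt_iff' _ (n + 2) (n + 1) n (by simp) (by simp),
      ShortComplex.moduleCat_exact_iff]
    intro x hx
    change (moduleComplex d hd).d (n + 1) n x = 0 at hx
    rw [moduleComplex_d] at hx
    obtain ⟨y, hy⟩ := h n x hx
    refine ⟨y, ?_⟩
    change (moduleComplex d hd).d (n + 2) (n + 1) y = x
    rw [moduleComplex_d]
    exact hy

/-- A short sequence of complexes which is exact in each degree. -/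
lemma moduleComplex_shortExact {f : ∀ n, M n →ₗ[ℚ] N n}
    {hf : ∀ n x, e n (f (n + 1) x) = f n (d n x)} {g : ∀ n, N n →ₗ[ℚ] P n}
    {hg : ∀ n x, b n (g (n + 1) x) = g n (e n x)}
    (hinj : ∀ n, Function.Injective (f n)) (hsurj : ∀ n, Function.Surjective (g n))
    (hex : ∀ n, Function.Exact (f n) (g n)) :
    (ShortComplex.mk (moduleComplexMap hd he f hf) (moduleComplexMap he hb g hg)
      (HomologicalComplex.hom_ext _ _ fun n => ModuleCat.hom_ext (LinearMap.ext fun x =>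
        (hex n (f n x)).2 ⟨x, rfl⟩))).ShortExact := by
  refine HomologicalComplex.shortExact_of_degreewise_shortExact _ fun n => ?_
  refine ShortComplex.ShortExact.mk' ?_ ?_ ?_
  · rw [ShortComplex.moduleCat_exact_iff]
    intro x hx
    exact (hex n x).1 hx
  · exact (ModuleCat.mono_iff_injective _).2 (hinj n)
  · exact (ModuleCat.epi_iff_surjective _).2 (hsurj n)

end ModuleComplex

lemma ShortComplex.ShortExact.isIso_homologyMap_of_exactAt
    {S : ShortComplex (ChainComplex (ModuleCat.{0} ℚ) ℕ)} (hS : S.ShortExact)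
    (h : ∀ n, S.X₃.ExactAt n) (n : ℕ) : IsIso (HomologicalComplex.homologyMap S.f n) := by
  have hm : Mono (HomologicalComplex.homologyMap S.f n) :=
    (hS.homology_exact₁ (n + 1) n rfl).mono_g ((h (n + 1)).isZero_homology.eq_of_src _ _)
  have he : Epi (HomologicalComplex.homologyMap S.f n) :=
    (hS.homology_exact₂ n).epi_f ((h n).isZero_homology.eq_of_tgt _ _)
  exact isIso_of_mono_of_epi _

section SingularComplex

variable (X : Type) [TopologicalSpace X]

/-- The rational singular chain complex. -/
noncomputable def singularComplex : ChainComplex (ModuleCat.{0} ℚ) ℕ :=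
  moduleComplex (M := fun n => SingularChain X (n + 1)) (fun n => SingularChain.boundary X (n + 1))
    (fun n => SingularChain.boundary_boundary (n + 1))

variable {X} {Y : Type} [TopologicalSpace Y]

/-- The map of singular chains induced by a continuous map. -/
noncomputable def SingularChain.map (f : C(X, Y)) (n : ℕ) :
    SingularChain X n →ₗ[ℚ] SingularChain Y n :=
  Finsupp.lmapDomain ℚ ℚ fun σ => f.comp σ

lemma SingularChain.map_single (f : C(X, Y)) (n : ℕ) (σ : C(stdSimplex ℝ (Fin n), X)) :
    SingularChain.map f n (Finsupp.single σ 1) = Finsupp.single (f.comp σ) 1 := by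
  simp [SingularChain.map, Finsupp.lmapDomain_apply]

lemma SingularChain.boundary_map (f : C(X, Y)) (n : ℕ) (c : SingularChain X (n + 1)) :
    boundary Y n (map f (n + 1) c) = map f n (boundary X n c) :=
  faceBoundary_comp_lmapDomain _ _ (fun n (σ : C(stdSimplex ℝ (Fin n), X)) => f.comp σ)
    (fun _ _ _ => rfl) n c

/-- The chain map induced by a continuous map. -/
noncomputable def singularComplexMap (f : C(X, Y)) : singularComplex X ⟶ singularComplex Y :=
  moduleComplexMap _ _ (fun n => SingularChain.map f (n + 1))
    (fun n => SingularChain.boundary_map f (n + 1))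

/-- The map in rational homology induced by a continuous map. -/
noncomputable def homologyMap (f : C(X, Y)) (n : ℕ) :
    rationalHomology X n →ₗ[ℚ] rationalHomology Y n :=
  (((singularHomologyFunctor (ModuleCat.{0} ℚ) n).obj (ModuleCat.of ℚ ℚ)).map
    (TopCat.ofHom f)).hom

variable (X) in
/-- The identification of singular simplices in the sense of Mathlib. -/
noncomputable def simplexEquiv (n : ℕ) :
    (TopCat.toSSet.obj (TopCat.of X)).obj (Opposite.op (SimplexCategory.mk n)) ≃
      C(stdSimplex ℝ (Fin (n + 1)), X) :=
  TopCat.toSSetObjEquiv (TopCat.of X) _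

lemma simplexEquiv_δ (n : ℕ) (i : Fin (n + 2))
    (x : (TopCat.toSSet.obj (TopCat.of X)).obj (Opposite.op (SimplexCategory.mk (n + 1)))) :
    simplexEquiv X n ((TopCat.toSSet.obj (TopCat.of X)).δ i x) =
      SingularChain.face (n + 1) i (simplexEquiv X (n + 1) x) := by
  rfl


/-- The inclusion of the summand of a simplex in Mathlib's singular complex. -/
noncomputable def ιSimplex (n : ℕ) (σ : C(stdSimplex ℝ (Fin (n + 1)), X)) :
    ModuleCat.of ℚ ℚ ⟶
      ((TopCat.toSSet.obj (TopCat.of X)).chainComplex (ModuleCat.of ℚ ℚ)).X n :=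
  (TopCat.toSSet.obj (TopCat.of X)).ιChainComplex ((simplexEquiv X n).symm σ)

lemma singularComplex_d (n : ℕ) :
    (singularComplex X).d (n + 1) n = ModuleCat.ofHom (SingularChain.boundary X (n + 1)) :=
  moduleComplex_d n

/-- The comparison map from the chain groups of Mathlib's singular complex. -/
noncomputable def singularComplexHomX (X : Type) [TopologicalSpace X] (n : ℕ) :
    ((TopCat.toSSet.obj (TopCat.of X)).chainComplex (ModuleCat.of ℚ ℚ)).X n ⟶
      ModuleCat.of ℚ (SingularChain X (n + 1)) :=
  ((TopCat.toSSet.obj (TopCat.of X)).isColimitChainComplexXCofan _ n).desc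
    (Cofan.mk (ModuleCat.of ℚ (SingularChain X (n + 1))) fun x =>
      ModuleCat.ofHom (Finsupp.lsingle (simplexEquiv X n x)))

lemma ι_singularComplexHomX (n : ℕ)
    (x : (TopCat.toSSet.obj (TopCat.of X)).obj (Opposite.op (SimplexCategory.mk n))) :
    (TopCat.toSSet.obj (TopCat.of X)).ιChainComplex x ≫ singularComplexHomX X n =
      ModuleCat.ofHom (Finsupp.lsingle (simplexEquiv X n x)) :=
  ((TopCat.toSSet.obj (TopCat.of X)).isColimitChainComplexXCofan _ n).fac _ ⟨x⟩

/-- The inverse of the comparison map. -/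
noncomputable def singularComplexInvX (X : Type) [TopologicalSpace X] (n : ℕ) :
    ModuleCat.of ℚ (SingularChain X (n + 1)) ⟶
      ((TopCat.toSSet.obj (TopCat.of X)).chainComplex (ModuleCat.of ℚ ℚ)).X n :=
  ModuleCat.ofHom (Finsupp.lsum ℚ fun σ => (ιSimplex n σ).hom)

lemma lsingle_singularComplexInvX (n : ℕ) (σ : C(stdSimplex ℝ (Fin (n + 1)), X)) :
    (ModuleCat.ofHom (Finsupp.lsingle σ) : ModuleCat.of ℚ ℚ ⟶ ModuleCat.of ℚ (SingularChain X (n + 1))) ≫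
      singularComplexInvX X n = ιSimplex n σ := by
  refine ModuleCat.hom_ext (LinearMap.ext fun q => ?_)
  change Finsupp.lsum ℚ (fun σ => (ιSimplex n σ).hom) (Finsupp.single σ q) = _
  exact Finsupp.lsum_single ℚ _ _ _

/-- The identification of the chain groups of Mathlib's singular complex. -/
noncomputable def singularComplexIsoX (X : Type) [TopologicalSpace X] (n : ℕ) :
    ((TopCat.toSSet.obj (TopCat.of X)).chainComplex (ModuleCat.of ℚ ℚ)).X n ≅
      ModuleCat.of ℚ (SingularChain X (n + 1)) where
  hom := singularComplexHomX X n
  inv := singularComplexInvX X n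
  hom_inv_id := by
    refine SSet.chainComplex_hom_ext fun x => ?_
    rw [← Category.assoc, ι_singularComplexHomX, Category.comp_id, lsingle_singularComplexInvX,
      ιSimplex, Equiv.symm_apply_apply]
  inv_hom_id := by
    refine ModuleCat.hom_ext (Finsupp.lhom_ext' fun σ => ?_)
    have h : (ModuleCat.ofHom (Finsupp.lsingle σ) : ModuleCat.of ℚ ℚ ⟶ ModuleCat.of ℚ (SingularChain X (n + 1))) ≫
        singularComplexInvX X n ≫ singularComplexHomX X n = ModuleCat.ofHom (Finsupp.lsingle σ) := by
      rw [← Category.assoc, lsingle_singularComplexInvX, ιSimplex, ι_singularComplexHomX,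
        Equiv.apply_symm_apply]
    exact congrArg ModuleCat.Hom.hom h

/-- Mathlib's singular complex is isomorphic to the explicit singular complex. -/
noncomputable def singularComplexIso (X : Type) [TopologicalSpace X] :
    (TopCat.toSSet.obj (TopCat.of X)).chainComplex (ModuleCat.of ℚ ℚ) ≅ singularComplex X :=
  HomologicalComplex.Hom.isoOfComponents (singularComplexIsoX X)
    (by
      rintro _ n rfl
      refine SSet.chainComplex_hom_ext fun x => ?_
      rw [singularComplex_d]
      change _ ≫ singularComplexHomX X (n + 1) ≫
        ModuleCat.ofHom (SingularChain.boundary X (n + 1)) = _ ≫ _ ≫ singularComplexHomX X n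
      rw [← Category.assoc, ι_singularComplexHomX, ← Category.assoc, SSet.ιChainComplex_d,
        Preadditive.sum_comp]
      simp only [Preadditive.zsmul_comp, ι_singularComplexHomX]
      refine ModuleCat.hom_ext (LinearMap.ext_ring ?_)
      change SingularChain.boundary X (n + 1) (Finsupp.single _ 1) = _
      rw [faceBoundary_single, ModuleCat.hom_sum, LinearMap.sum_apply]
      refine Finset.sum_congr rfl fun i _ => ?_
      rw [simplexEquiv_δ, ModuleCat.hom_zsmul, LinearMap.smul_apply, ← Int.cast_smul_eq_zsmul ℚ]
      push_cast
      rfl)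

lemma singularComplexIso_naturality (f : C(X, Y)) :
    SSet.chainComplexMap (TopCat.toSSet.map (TopCat.ofHom f)) (ModuleCat.of ℚ ℚ) ≫
      (singularComplexIso Y).hom = (singularComplexIso X).hom ≫ singularComplexMap f := by
  refine HomologicalComplex.hom_ext _ _ fun n => SSet.chainComplex_hom_ext fun x => ?_
  rw [HomologicalComplex.comp_f, HomologicalComplex.comp_f, ← Category.assoc,
    SSet.ι_chainComplexMap_f]
  change _ ≫ singularComplexHomX Y n = _ ≫ singularComplexHomX X n ≫
    ModuleCat.ofHom (SingularChain.map f (n + 1))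
  rw [← Category.assoc, ι_singularComplexHomX, ι_singularComplexHomX]
  refine ModuleCat.hom_ext (LinearMap.ext_ring ?_)
  exact (SingularChain.map_single f (n + 1) (simplexEquiv X n x)).symm

end SingularComplex

section MayerVietoris

variable {X Y Z : Type} [TopologicalSpace X] [TopologicalSpace Y] [TopologicalSpace Z]

variable (X) in
/-- Rational homology is the homology of the explicit singular complex. -/
noncomputable def homologyEquiv (n : ℕ) :
    rationalHomology X n ≃ₗ[ℚ] (singularComplex X).homology n :=
  ((HomologicalComplex.homologyFunctor _ _ n).mapIso (singularComplexIso X)).toLinearEquiv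

lemma homologyEquiv_naturality (f : C(X, Y)) (n : ℕ) (x : rationalHomology X n) :
    homologyEquiv Y n (homologyMap f n x) =
      (HomologicalComplex.homologyMap (singularComplexMap f) n).hom (homologyEquiv X n x) := by
  have h := congrArg (fun φ => HomologicalComplex.homologyMap φ n)
    (singularComplexIso_naturality f)
  simp only [HomologicalComplex.homologyMap_comp] at h
  exact congrArg (fun φ => ModuleCat.Hom.hom φ x) h

/-- The inclusion of a subset into a larger one. -/
def inclusionMap {U V : Set X} (h : U ⊆ V) : C(U, V) := ⟨Set.inclusion h, continuous_inclusion h⟩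

/-- The inclusion of a subset. -/
def subtypeMap (U : Set X) : C(U, X) := ⟨Subtype.val, continuous_subtype_val⟩

namespace SingularChain

lemma map_injective {f : C(X, Y)} (hf : Function.Injective f) (n : ℕ) :
    Function.Injective (map f n) :=
  Finsupp.mapDomain_injective fun σ τ h => by
    ext t
    exact hf (congrArg (fun ρ : C(stdSimplex ℝ (Fin n), Y) => ρ t) h)

lemma map_map (g : C(Y, Z)) (f : C(X, Y)) (n : ℕ) (c : SingularChain X n) :
    map g n (map f n c) = map (g.comp f) n c :=
  (Finsupp.mapDomain_comp (v := c)).symm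

lemma range_map_subtypeMap (U : Set X) (n : ℕ) :
    LinearMap.range (map (subtypeMap U) n) =
      Finsupp.supported ℚ ℚ {σ : C(stdSimplex ℝ (Fin n), X) | Set.range σ ⊆ U} := by
  rw [LinearMap.range_eq_map, ← Finsupp.supported_univ, map, Finsupp.lmapDomain_supported,
    Set.image_univ]
  congr 1
  ext σ
  constructor
  · rintro ⟨τ, rfl⟩ _ ⟨t, rfl⟩
    exact (τ t).2
  · intro h
    exact ⟨⟨fun t => ⟨σ t, h ⟨t, rfl⟩⟩, by fun_prop⟩, by ext t; rfl⟩

variable (U V : Set X)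

/-- The differences of chains in two subsets are small. -/
noncomputable def toSmall (n : ℕ) :
    (SingularChain U n × SingularChain V n) →ₗ[ℚ] small U V n :=
  LinearMap.codRestrict (small U V n)
    (LinearMap.coprod (map (subtypeMap U) n) (-map (subtypeMap V) n)) (by
      rintro ⟨a, b⟩
      rw [LinearMap.coprod_apply, LinearMap.neg_apply]
      have ha : map (subtypeMap U) n a ∈ LinearMap.range (map (subtypeMap U) n) := ⟨a, rfl⟩
      have hb : map (subtypeMap V) n b ∈ LinearMap.range (map (subtypeMap V) n) := ⟨b, rfl⟩
      rw [range_map_subtypeMap] at ha hb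
      exact add_mem (Finsupp.supported_mono (fun _ => Or.inl) ha)
        (neg_mem (Finsupp.supported_mono (fun _ => Or.inr) hb)))

lemma toSmall_coe (n : ℕ) (a : SingularChain U n) (b : SingularChain V n) :
    (toSmall U V n (a, b) : SingularChain X n) =
      map (subtypeMap U) n a - map (subtypeMap V) n b := by
  rw [sub_eq_add_neg]
  rfl

lemma toSmall_surjective (n : ℕ) : Function.Surjective (toSmall U V n) := by
  rintro ⟨c, hc⟩
  have h : small U V n = LinearMap.range (map (subtypeMap U) n) ⊔
      LinearMap.range (map (subtypeMap V) n) := by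
    rw [range_map_subtypeMap, range_map_subtypeMap, ← Finsupp.supported_union]
    rfl
  rw [h] at hc
  obtain ⟨_, ⟨a, rfl⟩, _, ⟨b, rfl⟩, rfl⟩ := Submodule.mem_sup.1 hc
  refine ⟨(a, -b), Subtype.ext ?_⟩
  rw [toSmall_coe, map_neg, sub_neg_eq_add]

/-- The two inclusions of chains in an intersection. -/
noncomputable def fromInter (n : ℕ) :
    SingularChain (U ∩ V : Set X) n →ₗ[ℚ] (SingularChain U n × SingularChain V n) :=
  (map (inclusionMap Set.inter_subset_left) n).prod (map (inclusionMap Set.inter_subset_right) n)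

lemma fromInter_injective (n : ℕ) : Function.Injective (fromInter U V n) := by
  intro a b h
  exact map_injective (Set.inclusion_injective Set.inter_subset_left) n (congrArg Prod.fst h)

lemma exact_fromInter_toSmall (n : ℕ) : Function.Exact (fromInter U V n) (toSmall U V n) := by
  rintro ⟨a, b⟩
  constructor
  · intro h
    have h' := congrArg Subtype.val h
    rw [toSmall_coe, Submodule.coe_zero, sub_eq_zero] at h'
    have ha : map (subtypeMap U) n a ∈ LinearMap.range (map (subtypeMap U) n) := ⟨a, rfl⟩
    have hb : map (subtypeMap U) n a ∈ LinearMap.range (map (subtypeMap V) n) := ⟨b, h'.symm⟩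
    have hab := Submodule.mem_inf.2 ⟨ha, hb⟩
    rw [range_map_subtypeMap, range_map_subtypeMap, ← Finsupp.supported_inter] at hab
    have hc : map (subtypeMap U) n a ∈ LinearMap.range (map (subtypeMap (U ∩ V)) n) := by
      rw [range_map_subtypeMap]
      exact Finsupp.supported_mono (fun σ hσ => Set.subset_inter hσ.1 hσ.2) hab
    obtain ⟨c, hc⟩ := hc
    refine ⟨c, Prod.ext ?_ ?_⟩
    · apply map_injective (f := subtypeMap U) Subtype.val_injective
      rw [← hc]
      exact map_map _ _ n c
    · apply map_injective (f := subtypeMap V) Subtype.val_injective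
      rw [← h', ← hc]
      exact map_map _ _ n c
  · rintro ⟨c, hc⟩
    rw [← hc]
    refine Subtype.ext ?_
    change (toSmall U V n (map _ n c, map _ n c) : SingularChain X n) = 0
    rw [toSmall_coe, map_map, map_map]
    exact sub_self _

/-- The boundary of small chains. -/
noncomputable def smallBoundary (n : ℕ) : small U V (n + 1) →ₗ[ℚ] small U V n :=
  (boundary X n).restrict fun _ => boundary_mem_small n

/-- The boundary of chains modulo small chains. -/
noncomputable def quotientBoundary (n : ℕ) :
    (SingularChain X (n + 1) ⧸ small U V (n + 1)) →ₗ[ℚ] (SingularChain X n ⧸ small U V n) :=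
  Submodule.mapQ _ _ (boundary X n) fun _ => boundary_mem_small n

end SingularChain

open SingularChain

variable (U V : Set X)

lemma smallBoundary_smallBoundary (n : ℕ) (c : small U V (n + 2)) :
    smallBoundary U V n (smallBoundary U V (n + 1) c) = 0 :=
  Subtype.ext (boundary_boundary n (c : SingularChain X (n + 2)))

lemma quotientBoundary_quotientBoundary (n : ℕ)
    (c : SingularChain X (n + 2) ⧸ small U V (n + 2)) :
    quotientBoundary U V n (quotientBoundary U V (n + 1) c) = 0 := by
  obtain ⟨c, rfl⟩ := Submodule.mkQ_surjective _ c
  change Submodule.Quotient.mk (boundary X n (boundary X (n + 1) c)) = _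
  rw [boundary_boundary, Submodule.Quotient.mk_zero]

/-- The inclusion of the complex of small chains. -/
noncomputable def smallInclusion :
    moduleComplex (M := fun n => small U V (n + 1)) (fun n => smallBoundary U V (n + 1))
      (fun n => smallBoundary_smallBoundary U V (n + 1)) ⟶ singularComplex X :=
  moduleComplexMap _ _ (fun n => (small U V (n + 1)).subtype) (fun _ _ => rfl)

lemma isIso_homologyMap_smallInclusion {U V : Set X} (hU : IsOpen U) (hV : IsOpen V)
    (hUV : U ∪ V = Set.univ) (n : ℕ) :
    IsIso (HomologicalComplex.homologyMap (smallInclusion U V) n) := by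
  refine ShortComplex.ShortExact.isIso_homologyMap_of_exactAt
    (moduleComplex_shortExact (M := fun n => small U V (n + 1))
      (N := fun n => SingularChain X (n + 1))
      (P := fun n => SingularChain X (n + 1) ⧸ small U V (n + 1))
      (d := fun n => smallBoundary U V (n + 1))
      (e := fun n => SingularChain.boundary X (n + 1))
      (b := fun n => quotientBoundary U V (n + 1))
      (hd := fun n => smallBoundary_smallBoundary U V (n + 1))
      (he := fun n => SingularChain.boundary_boundary (n + 1))
      (hb := fun n => quotientBoundary_quotientBoundary U V (n + 1))
      (f := fun n => (small U V (n + 1)).subtype)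
      (g := fun n => (small U V (n + 1)).mkQ) (hf := fun _ _ => rfl) (hg := fun _ _ => rfl)
      (fun n => Submodule.subtype_injective _) (fun n => Submodule.mkQ_surjective _)
      (fun n => LinearMap.exact_subtype_mkQ _)) ?_ n
  have key : ∀ n (c : SingularChain X (n + 1)), boundary X n c ∈ small U V n →
      ∃ y, quotientBoundary U V (n + 1) y = Submodule.Quotient.mk c := by
    intro n c hc
    obtain ⟨e, he⟩ := exists_sub_boundary_mem_small hU hV hUV n c hc
    refine ⟨Submodule.Quotient.mk e, ?_⟩
    exact ((Submodule.Quotient.eq _).2 he).symm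
  refine moduleComplex_exactAt (hd := fun n => quotientBoundary_quotientBoundary U V (n + 1))
    (fun x => ?_) (fun n x hx => ?_)
  · obtain ⟨c, rfl⟩ := Submodule.mkQ_surjective _ x
    refine key 0 c ?_
    rw [Finsupp.mem_supported]
    intro σ _
    left
    rintro _ ⟨t, rfl⟩
    exact absurd t.2.2 (by simp)
  · obtain ⟨c, rfl⟩ := Submodule.mkQ_surjective _ x
    exact key (n + 1) c ((Submodule.Quotient.mk_eq_zero _).1 hx)

/-- The product of two singular complexes. -/
noncomputable def prodComplex (X Y : Type) [TopologicalSpace X] [TopologicalSpace Y] :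
    ChainComplex (ModuleCat.{0} ℚ) ℕ :=
  moduleComplex (M := fun n => SingularChain X (n + 1) × SingularChain Y (n + 1))
    (fun n => (boundary X (n + 1)).prodMap (boundary Y (n + 1)))
    (fun n x => Prod.ext (boundary_boundary (n + 1) x.1) (boundary_boundary (n + 1) x.2))

/-- The first projection from a product of singular complexes. -/
noncomputable def prodComplexFst : prodComplex X Y ⟶ singularComplex X :=
  moduleComplexMap _ _ (fun _ => LinearMap.fst ℚ _ _) (fun _ _ => rfl)

/-- The second projection from a product of singular complexes. -/
noncomputable def prodComplexSnd : prodComplex X Y ⟶ singularComplex Y :=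
  moduleComplexMap _ _ (fun _ => LinearMap.snd ℚ _ _) (fun _ _ => rfl)

/-- The first inclusion into a product of singular complexes. -/
noncomputable def prodComplexInl : singularComplex X ⟶ prodComplex X Y :=
  moduleComplexMap _ _ (fun _ => LinearMap.inl ℚ _ _)
    (fun n _ => Prod.ext rfl (map_zero (boundary Y (n + 1))))

/-- The second inclusion into a product of singular complexes. -/
noncomputable def prodComplexInr : singularComplex Y ⟶ prodComplex X Y :=
  moduleComplexMap _ _ (fun _ => LinearMap.inr ℚ _ _)
    (fun n _ => Prod.ext (map_zero (boundary X (n + 1))) rfl)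

lemma prodComplexInl_fst : prodComplexInl (X := X) (Y := Y) ≫ prodComplexFst = 𝟙 _ := 
  HomologicalComplex.hom_ext _ _ fun _ => rfl

lemma prodComplexInr_snd : prodComplexInr (X := X) (Y := Y) ≫ prodComplexSnd = 𝟙 _ := 
  HomologicalComplex.hom_ext _ _ fun _ => rfl

lemma prodComplexInl_snd : prodComplexInl (X := X) (Y := Y) ≫ prodComplexSnd = 0 := 
  HomologicalComplex.hom_ext _ _ fun _ => rfl

lemma prodComplexInr_fst : prodComplexInr (X := X) (Y := Y) ≫ prodComplexFst = 0 := 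
  HomologicalComplex.hom_ext _ _ fun _ => rfl

lemma prodComplex_id : prodComplexFst ≫ prodComplexInl + prodComplexSnd ≫ prodComplexInr =
    𝟙 (prodComplex X Y) := by
  refine HomologicalComplex.hom_ext _ _ fun n => ModuleCat.hom_ext (LinearMap.ext fun x => ?_)
  exact Prod.ext (add_zero (Prod.fst (α := SingularChain X (n + 1)) x))
    (zero_add (Prod.snd (α := SingularChain X (n + 1)) (β := SingularChain Y (n + 1)) x))

open HomologicalComplex in
/-- The homology of a product of singular complexes. -/
noncomputable def prodComplexHomologyEquiv (X Y : Type) [TopologicalSpace X] [TopologicalSpace Y]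
    (n : ℕ) : (prodComplex X Y).homology n ≃ₗ[ℚ]
      (singularComplex X).homology n × (singularComplex Y).homology n :=
  LinearEquiv.ofLinearMap
    ((HomologicalComplex.homologyMap prodComplexFst n).hom.prod
      (HomologicalComplex.homologyMap prodComplexSnd n).hom)
    ((HomologicalComplex.homologyMap prodComplexInl n).hom.coprod
      (HomologicalComplex.homologyMap prodComplexInr n).hom)
    (by
      have h11 := congrArg (fun φ => HomologicalComplex.homologyMap φ n)
        (prodComplexInl_fst (X := X) (Y := Y))
      have h22 := congrArg (fun φ => HomologicalComplex.homologyMap φ n)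
        (prodComplexInr_snd (X := X) (Y := Y))
      have h12 := congrArg (fun φ => HomologicalComplex.homologyMap φ n)
        (prodComplexInl_snd (X := X) (Y := Y))
      have h21 := congrArg (fun φ => HomologicalComplex.homologyMap φ n)
        (prodComplexInr_fst (X := X) (Y := Y))
      simp only [homologyMap_comp, homologyMap_id, homologyMap_zero] at h11 h22 h12 h21
      refine LinearMap.ext fun ⟨x, y⟩ => Prod.ext ?_ ?_
      · have hx := congrArg (fun φ => ModuleCat.Hom.hom φ x) h11
        have hy := congrArg (fun φ => ModuleCat.Hom.hom φ y) h21
        change (HomologicalComplex.homologyMap prodComplexFst n).hom (_ + _) = _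
        rw [map_add]
        exact (congrArg₂ (· + ·) hx hy).trans (add_zero _)
      · have hx := congrArg (fun φ => ModuleCat.Hom.hom φ x) h12
        have hy := congrArg (fun φ => ModuleCat.Hom.hom φ y) h22
        change (HomologicalComplex.homologyMap prodComplexSnd n).hom (_ + _) = _
        rw [map_add]
        exact (congrArg₂ (· + ·) hx hy).trans (zero_add _))
    (by
      have h := congrArg (fun φ => HomologicalComplex.homologyMap φ n)
        (prodComplex_id (X := X) (Y := Y))
      simp only [homologyMap_comp, homologyMap_id, homologyMap_add] at h
      exact congrArg ModuleCat.Hom.hom h)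

lemma ShortComplex.ShortExact.surjective_homologyMap_zero
    {S : ShortComplex (ChainComplex (ModuleCat.{0} ℚ) ℕ)} (hS : S.ShortExact) :
    Function.Surjective (HomologicalComplex.homologyMap S.g 0).hom := by
  have := hS.epi_g
  have h1 : Epi (HomologicalComplex.opcyclesMap S.g 0) := by
    have h := HomologicalComplex.p_opcyclesMap S.g 0
    exact epi_of_epi_fac (h := S.g.f 0 ≫ S.X₃.pOpcycles 0) h
  have h2 : HomologicalComplex.homologyMap S.g 0 =
      S.X₂.homologyι 0 ≫ HomologicalComplex.opcyclesMap S.g 0 ≫ inv (S.X₃.homologyι 0) := by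
    rw [← Category.assoc, IsIso.eq_comp_inv, HomologicalComplex.homologyι_naturality]
  have h3 : Epi (HomologicalComplex.homologyMap S.g 0) := by
    rw [h2]
    infer_instance
  exact (ModuleCat.epi_iff_surjective _).1 h3

/-- The short complex of chains in an intersection, chains in the members of a cover, and small
chains. -/
noncomputable def mayerVietorisShortComplex : ShortComplex (ChainComplex (ModuleCat.{0} ℚ) ℕ) where
  X₁ := singularComplex (U ∩ V : Set X)
  X₂ := prodComplex U V
  X₃ := moduleComplex (M := fun n => small U V (n + 1)) (fun n => smallBoundary U V (n + 1))
      (fun n => smallBoundary_smallBoundary U V (n + 1))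
  f := moduleComplexMap _ _ (fun n => fromInter U V (n + 1))
    (fun n x => Prod.ext (boundary_map _ (n + 1) x) (boundary_map _ (n + 1) x))
  g := moduleComplexMap _ _ (fun n => toSmall U V (n + 1))
    (fun n x => Subtype.ext (by
        change boundary X (n + 1) (toSmall U V (n + 2) (x.1, x.2) : SingularChain X (n + 2)) =
          (toSmall U V (n + 1) (boundary U (n + 1) x.1, boundary V (n + 1) x.2) :
            SingularChain X (n + 1))
        rw [toSmall_coe, toSmall_coe, map_sub, boundary_map, boundary_map]))
  zero := HomologicalComplex.hom_ext _ _ fun n => ModuleCat.hom_ext (LinearMap.ext fun x =>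
        (exact_fromInter_toSmall U V (n + 1) (fromInter U V (n + 1) x)).2 ⟨x, rfl⟩)

lemma mayerVietorisShortComplex_shortExact : (mayerVietorisShortComplex U V).ShortExact :=
  moduleComplex_shortExact (M := fun n => SingularChain (U ∩ V : Set X) (n + 1))
    (N := fun n => SingularChain U (n + 1) × SingularChain V (n + 1))
    (P := fun n => small U V (n + 1))
    (fun _ => fromInter_injective U V _) (fun _ => toSmall_surjective U V _)
    (fun _ => exact_fromInter_toSmall U V _)

/-- The Mayer-Vietoris sequence of a cover by two open subsets. -/
theorem exists_mayerVietoris {U V : Set X} (hU : IsOpen U) (hV : IsOpen V)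
    (hUV : U ∪ V = Set.univ) :
    ∃ (g : ∀ n, (rationalHomology U n × rationalHomology V n) →ₗ[ℚ] rationalHomology X n)
      (δ : ∀ n, rationalHomology X (n + 1) →ₗ[ℚ] rationalHomology (U ∩ V : Set X) n),
      (∀ n, Function.Exact ((homologyMap (inclusionMap (Set.inter_subset_left : U ∩ V ⊆ U)) n).prod
        (homologyMap (inclusionMap (Set.inter_subset_right : U ∩ V ⊆ V)) n)) (g n)) ∧
      (∀ n, Function.Exact (g (n + 1)) (δ n)) ∧
      (∀ n, Function.Exact (δ n)
        ((homologyMap (inclusionMap (Set.inter_subset_left : U ∩ V ⊆ U)) n).prod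
        (homologyMap (inclusionMap (Set.inter_subset_right : U ∩ V ⊆ V)) n))) ∧
      Function.Surjective (g 0) := by
  have hS := mayerVietorisShortComplex_shortExact U V
  have := isIso_homologyMap_smallInclusion hU hV hUV
  let S := mayerVietorisShortComplex U V
  let e₁ : ∀ n, rationalHomology (U ∩ V : Set X) n ≃ₗ[ℚ] S.X₁.homology n := homologyEquiv (U ∩ V : Set X)
  let e₂ : ∀ n, (rationalHomology U n × rationalHomology V n) ≃ₗ[ℚ] S.X₂.homology n :=
    fun n => ((homologyEquiv U n).prodCongr (homologyEquiv V n)).trans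
    (prodComplexHomologyEquiv U V n).symm
  let e₃ : ∀ n, rationalHomology X n ≃ₗ[ℚ] S.X₃.homology n :=
    fun n => (homologyEquiv X n).trans
    (asIso (HomologicalComplex.homologyMap (smallInclusion U V) n)).toLinearEquiv.symm
  let iU : C((U ∩ V : Set X), U) := inclusionMap Set.inter_subset_left
  let iV : C((U ∩ V : Set X), V) := inclusionMap Set.inter_subset_right
  have comm : ∀ n, (HomologicalComplex.homologyMap S.f n).hom ∘ₗ (e₁ n : _ →ₗ[ℚ] _) =
      (e₂ n : _ →ₗ[ℚ] _) ∘ₗ (homologyMap iU n).prod (homologyMap iV n) := by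
    intro n
    refine LinearMap.ext fun x => ?_
    change _ = (prodComplexHomologyEquiv U V n).symm
      (homologyEquiv U n (homologyMap iU n x), homologyEquiv V n (homologyMap iV n x))
    refine (LinearEquiv.eq_symm_apply _).2 ?_
    rw [homologyEquiv_naturality, homologyEquiv_naturality]
    let f : singularComplex (U ∩ V : Set X) ⟶ prodComplex U V := S.f
    have h1 : f ≫ prodComplexFst = singularComplexMap iU :=
      HomologicalComplex.hom_ext _ _ fun _ => rfl
    have h2 : f ≫ prodComplexSnd = singularComplexMap iV :=
      HomologicalComplex.hom_ext _ _ fun _ => rfl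
    rw [← h1, ← h2, HomologicalComplex.homologyMap_comp, HomologicalComplex.homologyMap_comp]
    rfl
  refine ⟨fun n => ((e₃ n).symm : _ →ₗ[ℚ] _) ∘ₗ
      (HomologicalComplex.homologyMap S.g n).hom ∘ₗ (e₂ n : _ →ₗ[ℚ] _),
    fun n => ((e₁ n).symm : _ →ₗ[ℚ] _) ∘ₗ (hS.δ (n + 1) n rfl).hom ∘ₗ (e₃ (n + 1) : _ →ₗ[ℚ] _),
    fun n => ?_, fun n => ?_, fun n => ?_, ?_⟩
  · refine (Function.Exact.iff_of_ladder_linearEquiv (e₁ := e₁ n) (e₂ := e₂ n) (e₃ := e₃ n)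
      (comm n) ?_).1 ((ShortComplex.ShortExact.moduleCat_exact_iff_function_exact _).1
        (hS.homology_exact₂ n))
    exact LinearMap.ext fun x => ((e₃ n).apply_symm_apply _).symm
  · refine (Function.Exact.iff_of_ladder_linearEquiv (e₁ := e₂ (n + 1)) (e₂ := e₃ (n + 1))
      (e₃ := e₁ n) ?_ ?_).1 ((ShortComplex.ShortExact.moduleCat_exact_iff_function_exact _).1
        (hS.homology_exact₃ (n + 1) n rfl))
    · exact LinearMap.ext fun x => ((e₃ (n + 1)).apply_symm_apply _).symm
    · exact LinearMap.ext fun x => ((e₁ n).apply_symm_apply _).symm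
  · refine (Function.Exact.iff_of_ladder_linearEquiv (e₁ := e₃ (n + 1)) (e₂ := e₁ n)
      (e₃ := e₂ n) ?_ (comm n)).1
        ((ShortComplex.ShortExact.moduleCat_exact_iff_function_exact _).1
        (hS.homology_exact₁ (n + 1) n rfl))
    exact LinearMap.ext fun x => ((e₁ n).apply_symm_apply _).symm
  · exact (e₃ 0).symm.surjective.comp
      ((ShortComplex.ShortExact.surjective_homologyMap_zero hS).comp (e₂ 0).surjective)

end MayerVietoris

section HomotopyInvariance

variable {X Y Z : Type} [TopologicalSpace X] [TopologicalSpace Y] [TopologicalSpace Z]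

lemma homologyMap_id (n : ℕ) : homologyMap (ContinuousMap.id X) n = LinearMap.id := by
  rw [homologyMap, TopCat.ofHom_id, CategoryTheory.Functor.map_id]
  rfl

lemma homologyMap_comp (g : C(Y, Z)) (f : C(X, Y)) (n : ℕ) :
    homologyMap (g.comp f) n = homologyMap g n ∘ₗ homologyMap f n := by
  rw [homologyMap, TopCat.ofHom_comp, CategoryTheory.Functor.map_comp]
  rfl

lemma homologyMap_eq_of_homotopic {f g : C(X, Y)} (h : f.Homotopic g) (n : ℕ) :
    homologyMap f n = homologyMap g n := by
  obtain ⟨H⟩ := h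
  have := TopCat.Homotopy.congr_homologyMap_singularChainComplexFunctor
    (f := TopCat.ofHom f) (g := TopCat.ofHom g) H (ModuleCat.of ℚ ℚ) n
  exact congrArg ModuleCat.Hom.hom this

lemma homologyMap_surjective_of_section {f : C(X, Y)} (g : C(Y, X))
    (h : f.comp g = ContinuousMap.id Y) (n : ℕ) : Function.Surjective (homologyMap f n) := by
  intro y
  refine ⟨homologyMap g n y, ?_⟩
  rw [← LinearMap.comp_apply, ← homologyMap_comp, h, homologyMap_id, LinearMap.id_apply]

lemma homologyMap_bijective_of_homotopyInverse {f : C(X, Y)} (g : C(Y, X))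
    (hfg : (f.comp g).Homotopic (ContinuousMap.id Y))
    (hgf : (g.comp f).Homotopic (ContinuousMap.id X)) (n : ℕ) :
    Function.Bijective (homologyMap f n) := by
  have h1 := homologyMap_eq_of_homotopic hfg n
  have h2 := homologyMap_eq_of_homotopic hgf n
  rw [homologyMap_comp, homologyMap_id] at h1 h2
  exact Function.bijective_iff_has_inverse.2 ⟨homologyMap g n,
    fun x => congrArg (fun φ => φ x) h2, fun y => congrArg (fun φ => φ y) h1⟩

lemma homologyMap_bijective_of_homeomorph (e : X ≃ₜ Y) (n : ℕ) :
    Function.Bijective (homologyMap (e : C(X, Y)) n) :=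
  homologyMap_bijective_of_homotopyInverse (e.symm : C(Y, X))
    (by
      rw [show (e : C(X, Y)).comp (e.symm : C(Y, X)) = ContinuousMap.id Y from
        ContinuousMap.ext e.apply_symm_apply]) (by
      rw [show (e.symm : C(Y, X)).comp (e : C(X, Y)) = ContinuousMap.id X from
        ContinuousMap.ext e.symm_apply_apply]) n

lemma IsPoincarePolynomial.of_homeomorph {P : Polynomial ℤ} (h : IsPoincarePolynomial X P)
    (e : X ≃ₜ Y) : IsPoincarePolynomial Y P := by
  intro n
  have E := LinearEquiv.ofBijective _ (homologyMap_bijective_of_homeomorph e n)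
  have := (h n).1
  exact ⟨Module.Finite.equiv E, by rw [(h n).2, E.finrank_eq]⟩

lemma subsingleton_rationalHomology_of_isEmpty [IsEmpty X] (n : ℕ) :
    Subsingleton (rationalHomology X n) := by
  have h0 : ∀ n, Subsingleton (SingularChain X (n + 1)) := fun n => by
    have : IsEmpty C(stdSimplex ℝ (Fin (n + 1)), X) :=
      ⟨fun σ => isEmptyElim (σ (stdSimplex.vertex 0))⟩
    infer_instance
  have h := (moduleComplex_exactAt (M := fun n => SingularChain X (n + 1))
    (d := fun n => SingularChain.boundary X (n + 1))
    (hd := fun n => SingularChain.boundary_boundary (n + 1))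
    (fun x => ⟨0, (h0 0).elim _ _⟩) (fun m x _ => ⟨0, (h0 (m + 1)).elim _ _⟩) n).isZero_homology
  have h' : Subsingleton ((singularComplex X).homology n) :=
    ModuleCat.subsingleton_of_isZero h
  exact (homologyEquiv X n).toEquiv.subsingleton

lemma isPoincarePolynomial_of_isEmpty [IsEmpty X] : IsPoincarePolynomial X 0 := by
  intro n
  have := subsingleton_rationalHomology_of_isEmpty (X := X) n
  exact ⟨inferInstance, by simp [Module.finrank_zero_of_subsingleton]⟩

lemma isPoincarePolynomial_of_unique [Unique X] : IsPoincarePolynomial X 1 := by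
  have : TotallyDisconnectedSpace (TopCat.of X) :=
    inferInstanceAs (TotallyDisconnectedSpace X)
  have : Unique (TopCat.of X) := inferInstanceAs (Unique X)
  intro n
  rcases eq_or_ne n 0 with rfl | hn
  · have e : rationalHomology X 0 ≃ₗ[ℚ] ℚ :=
      (singularHomologyFunctorZeroOfTotallyDisconnectedSpace (ModuleCat.{0} ℚ)
        (ModuleCat.of ℚ ℚ) (TopCat.of X) ≪≫ coproductUniqueIso _).toLinearEquiv
    exact ⟨Module.Finite.equiv e.symm, by simp [e.finrank_eq]⟩
  · have h : Subsingleton (rationalHomology X n) := ModuleCat.subsingleton_of_isZero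
      (isZero_singularHomologyFunctor_of_totallyDisconnectedSpace (ModuleCat.{0} ℚ) n
        (ModuleCat.of ℚ ℚ) (TopCat.of X) hn)
    exact ⟨inferInstance, by
      simp [Module.finrank_zero_of_subsingleton, Polynomial.coeff_one, hn]⟩

end HomotopyInvariance

section Dimensions

variable {X A B C : Type} [TopologicalSpace X] [TopologicalSpace A] [TopologicalSpace B]
  [TopologicalSpace C]

lemma finrank_of_exact {K L M N : Type} [AddCommGroup K] [AddCommGroup L] [AddCommGroup M]
    [AddCommGroup N] [Module ℚ K] [Module ℚ L] [Module ℚ M] [Module ℚ N]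
    [Module.Finite ℚ L] [Module.Finite ℚ N] (f : K →ₗ[ℚ] L) (g : L →ₗ[ℚ] M) (h : M →ₗ[ℚ] N)
    (hfg : Function.Exact f g) (hgh : Function.Exact g h) :
    Module.Finite ℚ M ∧ Module.finrank ℚ M + Module.finrank ℚ (LinearMap.range f) =
      Module.finrank ℚ L + Module.finrank ℚ (LinearMap.range h) := by
  have h1 : LinearMap.ker g = LinearMap.range f := LinearMap.exact_iff.1 hfg
  have h2 : LinearMap.ker h = LinearMap.range g := LinearMap.exact_iff.1 hgh
  have hfin : Module.Finite ℚ M := by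
    have : Module.Finite ℚ (LinearMap.ker h) := by rw [h2]; infer_instance
    have : Module.Finite ℚ (M ⧸ LinearMap.ker h) := Module.Finite.equiv h.quotKerEquivRange.symm
    exact Module.Finite.of_submodule_quotient (LinearMap.ker h)
  refine ⟨hfin, ?_⟩
  have e1 := LinearMap.finrank_range_add_finrank_ker g
  have e2 := LinearMap.finrank_range_add_finrank_ker h
  rw [h1] at e1
  rw [h2] at e2
  omega

/-- The Mayer-Vietoris sequence, with the members of the cover and their intersection replaced
by spaces with the same homology. -/
theorem finrank_rationalHomology_of_cover {U V : Set X} (hU : IsOpen U) (hV : IsOpen V)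
    (hUV : U ∪ V = Set.univ) (pU : C(U, A)) (pV : C(V, B)) (s : C(C, (U ∩ V : Set X)))
    (hpU : ∀ n, Function.Bijective (homologyMap pU n))
    (hpV : ∀ n, Function.Bijective (homologyMap pV n))
    (hs : ∀ n, Function.Bijective (homologyMap s n))
    (α : C(C, A)) (β : C(C, B))
    (hα : (pU.comp (inclusionMap Set.inter_subset_left)).comp s = α)
    (hβ : (pV.comp (inclusionMap Set.inter_subset_right)).comp s = β)
    (hA : ∀ n, Module.Finite ℚ (rationalHomology A n))
    (hB : ∀ n, Module.Finite ℚ (rationalHomology B n))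
    (hC : ∀ n, Module.Finite ℚ (rationalHomology C n)) :
    (∀ n, Module.Finite ℚ (rationalHomology X n)) ∧
    (Module.finrank ℚ (rationalHomology X 0) +
        Module.finrank ℚ (LinearMap.range ((homologyMap α 0).prod (homologyMap β 0))) =
      Module.finrank ℚ (rationalHomology A 0) + Module.finrank ℚ (rationalHomology B 0)) ∧
    ∀ n, Module.finrank ℚ (rationalHomology X (n + 1)) +
        Module.finrank ℚ (LinearMap.range ((homologyMap α (n + 1)).prod (homologyMap β (n + 1)))) =
      Module.finrank ℚ (rationalHomology A (n + 1)) +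
        Module.finrank ℚ (rationalHomology B (n + 1)) +
        Module.finrank ℚ (LinearMap.ker ((homologyMap α n).prod (homologyMap β n))) := by
  obtain ⟨g, δ, h1, h2, h3, h4⟩ := exists_mayerVietoris hU hV hUV
  let eU := fun n => LinearEquiv.ofBijective _ (hpU n)
  let eV := fun n => LinearEquiv.ofBijective _ (hpV n)
  let es := fun n => LinearEquiv.ofBijective _ (hs n)
  let e := fun n => (eU n).prodCongr (eV n)
  have comm : ∀ n, (homologyMap α n).prod (homologyMap β n) =
      ((e n : _ →ₗ[ℚ] _) ∘ₗ
        ((homologyMap (inclusionMap (Set.inter_subset_left : U ∩ V ⊆ U)) n).prod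
        (homologyMap (inclusionMap (Set.inter_subset_right : U ∩ V ⊆ V)) n))) ∘ₗ
        (es n : _ →ₗ[ℚ] _) := by
    intro n
    rw [← hα, ← hβ, homologyMap_comp, homologyMap_comp, homologyMap_comp, homologyMap_comp]
    rfl
  have comm' : ∀ n,
      ((homologyMap (inclusionMap (Set.inter_subset_left : U ∩ V ⊆ U)) n).prod
        (homologyMap (inclusionMap (Set.inter_subset_right : U ∩ V ⊆ V)) n)) ∘ₗ
          (es n : _ →ₗ[ℚ] _) =
      ((e n).symm : _ →ₗ[ℚ] _) ∘ₗ (homologyMap α n).prod (homologyMap β n) := by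
    intro n
    rw [comm]
    exact LinearMap.ext fun x => ((e n).symm_apply_apply _).symm
  have h1' : ∀ n, Function.Exact ((homologyMap α n).prod (homologyMap β n))
      (g n ∘ₗ ((e n).symm : _ →ₗ[ℚ] _)) := fun n =>
    (Function.Exact.iff_of_ladder_linearEquiv (g₂₃ := g n) (e₁ := es n) (e₂ := (e n).symm)
      (e₃ := LinearEquiv.refl ℚ _) (comm' n) (LinearMap.ext fun _ => rfl)).1 (h1 n)
  have h2' : ∀ n, Function.Exact (g (n + 1) ∘ₗ ((e (n + 1)).symm : _ →ₗ[ℚ] _))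
      (((es n).symm : _ →ₗ[ℚ] _) ∘ₗ δ n) := fun n =>
    (Function.Exact.iff_of_ladder_linearEquiv (g₁₂ := g (n + 1)) (g₂₃ := δ n)
      (e₁ := (e (n + 1)).symm) (e₂ := LinearEquiv.refl ℚ _) (e₃ := es n)
      (LinearMap.ext fun _ => rfl)
      (LinearMap.ext fun x => ((es n).apply_symm_apply _).symm)).1 (h2 n)
  have h3' : ∀ n, Function.Exact (((es n).symm : _ →ₗ[ℚ] _) ∘ₗ δ n)
      ((homologyMap α n).prod (homologyMap β n)) := fun n =>
    (Function.Exact.iff_of_ladder_linearEquiv (g₁₂ := δ n) (e₁ := LinearEquiv.refl ℚ _)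
      (e₂ := es n) (e₃ := (e n).symm)
      (LinearMap.ext fun x => ((es n).apply_symm_apply _).symm) (comm' n)).1 (h3 n)
  have hz : Function.Exact (g 0 ∘ₗ (e 0).symm.toLinearMap)
      (0 : rationalHomology X 0 →ₗ[ℚ] ℚ) :=
    fun y => ⟨fun _ => (h4.comp (e 0).symm.surjective) y, fun _ => rfl⟩
  have h0 := finrank_of_exact _ _ _ (h1' 0) hz
  have hn := fun n => finrank_of_exact _ _ _ (h1' (n + 1)) (h2' n)
  refine ⟨fun n => ?_, ?_, fun n => ?_⟩
  · cases n with
    | zero => exact h0.1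
    | succ n => exact (hn n).1
  · have := h0.2
    rwa [LinearMap.range_zero, finrank_bot, add_zero, Module.finrank_prod] at this
  · have := (hn n).2
    rwa [← LinearMap.exact_iff.1 (h3' n), Module.finrank_prod] at this

end Dimensions

end Homology

/-! ## Punctured spaces and associated bundles -/

section Sphere

variable {E F : Type} [NormedAddCommGroup E]

/-- The complement of the origin. -/
abbrev Punctured (E : Type) [Zero E] : Type := {x : E // x ≠ 0}

/-- The part of a punctured space away from a ray, times a factor. -/
def offRay (E F : Type) [NormedAddCommGroup E] (ε : ℝ) : Set (Punctured (E × ℝ) × F) :=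
  {p | p.1.1.1 ≠ 0 ∨ 0 < ε * p.1.1.2}

lemma prod_ne_zero_of_offRay {ε : ℝ} {x : E} {τ : ℝ} (h : x ≠ 0 ∨ 0 < ε * τ) :
    (x, τ) ≠ (0 : E × ℝ) := by
  rintro h0
  rw [Prod.ext_iff] at h0
  rcases h with h | h
  · exact h h0.1
  · simp only [Prod.snd_zero] at h0
    simp [h0.2] at h

lemma fst_ne_zero_of_offRay {p : Punctured (E × ℝ) × F}
    (hp : p ∈ offRay E F 1 ∩ offRay E F (-1)) : p.1.1.1 ≠ 0 := by
  rcases hp with ⟨h | h, h' | h'⟩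
  · exact h
  · exact h
  · exact h'
  · exfalso
    linarith

variable [TopologicalSpace F]

lemma isOpen_offRay (ε : ℝ) : IsOpen (offRay E F ε) :=
  (isOpen_ne.preimage (f := fun p : Punctured (E × ℝ) × F => p.1.1.1) (by fun_prop)).union
    (isOpen_lt (f := fun _ : Punctured (E × ℝ) × F => (0 : ℝ)) continuous_const (by fun_prop))

/-- The projection to the second factor. -/
def offRayProj (E F : Type) [NormedAddCommGroup E] [TopologicalSpace F] (ε : ℝ) :
    C(offRay E F ε, F) := ⟨fun p => p.1.2, by fun_prop⟩

/-- The inclusion of a hyperplane, times a factor. -/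
def hyperplaneIncl (E F : Type) [NormedAddCommGroup E] [TopologicalSpace F] : C(Punctured E × F, (offRay E F 1 ∩ offRay E F (-1) : Set _)) :=
  ⟨fun p => ⟨(⟨(p.1.1, 0), fun h => p.1.2 (congrArg Prod.fst h)⟩, p.2),
    Or.inl p.1.2, Or.inl p.1.2⟩, by fun_prop⟩

lemma homologyMap_hyperplaneIncl_bijective (n : ℕ) :
    Function.Bijective (homologyMap (hyperplaneIncl E F) n) := by
  let g : C((offRay E F 1 ∩ offRay E F (-1) : Set _), Punctured E × F) :=
    ⟨fun p => (⟨p.1.1.1.1, fst_ne_zero_of_offRay p.2⟩, p.1.2), by fun_prop⟩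
  refine homologyMap_bijective_of_homotopyInverse g ?_ ?_ n
  · refine ⟨⟨⟨fun p => ⟨(⟨(p.2.1.1.1.1, p.1 * p.2.1.1.1.2),
        fun h => fst_ne_zero_of_offRay p.2.2 (congrArg Prod.fst h)⟩, p.2.1.2),
        Or.inl (fst_ne_zero_of_offRay (p := p.2.1) p.2.2), Or.inl (fst_ne_zero_of_offRay (p := p.2.1) p.2.2)⟩,
        by fun_prop⟩, ?_, ?_⟩⟩
    · rintro ⟨⟨⟨⟨x, τ⟩, hx⟩, f⟩, hp⟩
      simp [g, hyperplaneIncl]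
    · rintro ⟨⟨⟨⟨x, τ⟩, hx⟩, f⟩, hp⟩
      simp
  · exact ContinuousMap.Homotopic.refl _

variable [NormedSpace ℝ E]

lemma offRay_segment {ε : ℝ} (hε : ε ≠ 0) {x : E} {τ : ℝ} (h : x ≠ 0 ∨ 0 < ε * τ)
    (t : unitInterval) : (1 - (t : ℝ)) • x ≠ 0 ∨ 0 < ε * ((1 - (t : ℝ)) * τ + t * ε) := by
  have hε2 : 0 < ε * ε := mul_self_pos.2 hε
  have ht := t.2
  rcases eq_or_lt_of_le ht.2 with h1 | h1
  · right
    rw [h1]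
    simpa using hε2
  · rcases h with h | h
    · exact Or.inl (smul_ne_zero (by linarith) h)
    · right
      have : ε * ((1 - (t : ℝ)) * τ + t * ε) = (1 - (t : ℝ)) * (ε * τ) + t * (ε * ε) := by ring
      rw [this]
      have h2 : 0 < (1 - (t : ℝ)) * (ε * τ) := mul_pos (by linarith) h
      have h3 : 0 ≤ (t : ℝ) * (ε * ε) := mul_nonneg ht.1 hε2.le
      linarith

lemma homologyMap_offRayProj_bijective {ε : ℝ} (hε : ε ≠ 0) (n : ℕ) :
    Function.Bijective (homologyMap (offRayProj E F ε) n) := by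
  have h0 : (0 : E) ≠ 0 ∨ 0 < ε * ε := Or.inr (mul_self_pos.2 hε)
  let g : C(F, offRay E F ε) :=
    ⟨fun f => ⟨(⟨(0, ε), prod_ne_zero_of_offRay h0⟩, f), h0⟩, by fun_prop⟩
  refine homologyMap_bijective_of_homotopyInverse g ?_ ?_ n
  · exact ContinuousMap.Homotopic.refl _
  · refine ContinuousMap.Homotopic.symm ⟨⟨⟨fun p =>
      ⟨(⟨((1 - (p.1 : ℝ)) • p.2.1.1.1.1, (1 - (p.1 : ℝ)) * p.2.1.1.1.2 + p.1 * ε),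
        prod_ne_zero_of_offRay (offRay_segment hε p.2.2 p.1)⟩, p.2.1.2),
        offRay_segment hε p.2.2 p.1⟩, by fun_prop⟩, ?_, ?_⟩⟩
    · rintro ⟨⟨⟨⟨x, τ⟩, hx⟩, f⟩, hp⟩
      simp
    · rintro ⟨⟨⟨⟨x, τ⟩, hx⟩, f⟩, hp⟩
      simp [g]
      rfl

/-- The second projection. -/
def sndMap (A F : Type) [TopologicalSpace A] [TopologicalSpace F] : C(A × F, F) :=
  ⟨Prod.snd, continuous_snd⟩

lemma homologyMap_sndMap_surjective {A : Type} [TopologicalSpace A] [Nonempty A] (n : ℕ) :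
    Function.Surjective (homologyMap (sndMap A F) n) :=
  homologyMap_surjective_of_section
    ⟨fun f => (Classical.arbitrary A, f), by fun_prop⟩ rfl n

lemma finrank_range_prod_self {K L : Type} [AddCommGroup K] [AddCommGroup L] [Module ℚ K]
    [Module ℚ L] (f : K →ₗ[ℚ] L) [Module.Finite ℚ K] :
    Module.finrank ℚ (LinearMap.range (f.prod f)) = Module.finrank ℚ (LinearMap.range f) := by
  have h1 := LinearMap.finrank_range_add_finrank_ker f
  have h2 := LinearMap.finrank_range_add_finrank_ker (f.prod f)
  rw [LinearMap.ker_prod, inf_idem] at h2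
  omega

/-- The homology of a punctured space with one more dimension. -/
lemma finrank_rationalHomology_punctured_prod
    (hF : ∀ n, Module.Finite ℚ (rationalHomology F n))
    (hE : ∀ n, Module.Finite ℚ (rationalHomology (Punctured E × F) n)) :
    (∀ n, Module.Finite ℚ (rationalHomology (Punctured (E × ℝ) × F) n)) ∧
    (Module.finrank ℚ (rationalHomology (Punctured (E × ℝ) × F) 0) +
        Module.finrank ℚ (LinearMap.range (homologyMap (sndMap (Punctured E) F) 0)) =
      Module.finrank ℚ (rationalHomology F 0) + Module.finrank ℚ (rationalHomology F 0)) ∧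
    ∀ n, Module.finrank ℚ (rationalHomology (Punctured (E × ℝ) × F) (n + 1)) +
        Module.finrank ℚ (LinearMap.range (homologyMap (sndMap (Punctured E) F) (n + 1))) +
        Module.finrank ℚ (LinearMap.range (homologyMap (sndMap (Punctured E) F) n)) =
      Module.finrank ℚ (rationalHomology F (n + 1)) +
        Module.finrank ℚ (rationalHomology F (n + 1)) +
        Module.finrank ℚ (rationalHomology (Punctured E × F) n) := by
  have hcover : offRay E F 1 ∪ offRay E F (-1) = Set.univ := by
    refine Set.eq_univ_of_forall fun p => ?_
    by_cases hx : p.1.1.1 = 0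
    · have hτ : p.1.1.2 ≠ 0 := fun h => p.1.2 (Prod.ext hx h)
      rcases lt_or_gt_of_ne hτ with h | h
      · exact Or.inr (Or.inr (by linarith))
      · exact Or.inl (Or.inr (by linarith))
    · exact Or.inl (Or.inl hx)
  obtain ⟨h1, h2, h3⟩ := finrank_rationalHomology_of_cover (isOpen_offRay 1) (isOpen_offRay (-1))
    hcover (offRayProj E F 1) (offRayProj E F (-1)) (hyperplaneIncl E F)
    (homologyMap_offRayProj_bijective one_ne_zero)
    (homologyMap_offRayProj_bijective (by norm_num))
    homologyMap_hyperplaneIncl_bijective (sndMap _ _) (sndMap _ _) rfl rfl hF hF hE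
  refine ⟨h1, ?_, fun n => ?_⟩
  · rw [finrank_range_prod_self] at h2
    exact h2
  · have h := h3 n
    rw [finrank_range_prod_self, LinearMap.ker_prod, inf_idem] at h
    have := LinearMap.finrank_range_add_finrank_ker (homologyMap (sndMap (Punctured E) F) n)
    omega

/-- A linear homeomorphism restricts to punctured spaces. -/
def puncturedHomeomorph {E E' : Type} [NormedAddCommGroup E] [NormedSpace ℝ E]
    [NormedAddCommGroup E'] [NormedSpace ℝ E'] (e : E ≃L[ℝ] E') : Punctured E ≃ₜ Punctured E' :=
  e.toHomeomorph.subtype fun x => by simp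

open Polynomial in
theorem isPoincarePolynomial_punctured_prod {P : ℤ[X]} (hP : IsPoincarePolynomial F P) :
    ∀ (n : ℕ) (E : Type) [NormedAddCommGroup E] [NormedSpace ℝ E] [FiniteDimensional ℝ E],
      Module.finrank ℝ E = n + 1 →
      IsPoincarePolynomial (Punctured E × F) ((1 + X ^ n) * P) := by
  intro n
  induction n with
  | zero =>
    intro E _ _ _ hE
    have e : ((Fin 0 → ℝ) × ℝ) ≃L[ℝ] E :=
      ContinuousLinearEquiv.ofFinrankEq (by simp [hE])
    refine IsPoincarePolynomial.of_homeomorph ?_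
      ((puncturedHomeomorph e).prodCongr (Homeomorph.refl F))
    have : IsEmpty (Punctured (Fin 0 → ℝ)) := ⟨fun x => x.2 (Subsingleton.elim _ _)⟩
    have hs := fun n => subsingleton_rationalHomology_of_isEmpty
      (X := Punctured (Fin 0 → ℝ) × F) n
    obtain ⟨h1, h2, h3⟩ := finrank_rationalHomology_punctured_prod (E := Fin 0 → ℝ)
      (fun n => (hP n).1) (fun n => inferInstance)
    have hr : ∀ n, Module.finrank ℚ (LinearMap.range
        (homologyMap (sndMap (Punctured (Fin 0 → ℝ)) F) n)) = 0 := fun n => by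
      rw [LinearMap.range_eq_bot.2 (LinearMap.ext fun x => by
        rw [(hs n).elim x 0, map_zero, map_zero]), finrank_bot]
    intro k
    refine ⟨h1 k, ?_⟩
    rw [pow_zero, add_mul, one_mul, coeff_add, (hP k).2]
    cases k with
    | zero =>
      rw [hr] at h2
      exact_mod_cast h2.symm
    | succ k =>
      have h3' := h3 k
      rw [hr, hr, Module.finrank_zero_of_subsingleton
        (M := rationalHomology (Punctured (Fin 0 → ℝ) × F) k)] at h3'
      exact_mod_cast h3'.symm
  | succ n ih =>
    intro E _ _ _ hE
    have e : ((Fin (n + 1) → ℝ) × ℝ) ≃L[ℝ] E :=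
      ContinuousLinearEquiv.ofFinrankEq (by simp [hE])
    refine IsPoincarePolynomial.of_homeomorph ?_
      ((puncturedHomeomorph e).prodCongr (Homeomorph.refl F))
    have hE' := ih (Fin (n + 1) → ℝ) (by simp)
    obtain ⟨h1, h2, h3⟩ := finrank_rationalHomology_punctured_prod (E := Fin (n + 1) → ℝ)
      (fun n => (hP n).1) (fun n => (hE' n).1)
    have : Nonempty (Punctured (Fin (n + 1) → ℝ)) := ⟨⟨1, one_ne_zero⟩⟩
    have hr : ∀ k, Module.finrank ℚ (LinearMap.range
        (homologyMap (sndMap (Punctured (Fin (n + 1) → ℝ)) F) k)) =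
          Module.finrank ℚ (rationalHomology F k) := fun k => by
      rw [LinearMap.range_eq_top.2 (homologyMap_sndMap_surjective k), finrank_top]
    intro k
    refine ⟨h1 k, ?_⟩
    rw [add_mul, one_mul, coeff_add, (hP k).2]
    cases k with
    | zero =>
      rw [hr] at h2
      rw [coeff_X_pow_mul', if_neg (by omega)]
      omega
    | succ k =>
      have h3' := h3 k
      have h4 := (hE' k).2
      rw [add_mul, one_mul, coeff_add, (hP k).2] at h4
      rw [hr, hr] at h3'
      rw [pow_succ, mul_assoc, mul_comm X, ← mul_assoc, coeff_mul_X]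
      omega

end Sphere

section OpenQuotient

variable {A B Z : Type} [TopologicalSpace A] [TopologicalSpace B] [TopologicalSpace Z]

/-- Descend a continuous map along an open quotient map. -/
noncomputable def descend {q : A → B} (hq : IsOpenQuotientMap q) (g : C(A, Z))
    (h : ∀ a a', q a = q a' → g a = g a') : C(B, Z) where
  toFun b := g (hq.surjective b).choose
  continuous_toFun := by
    refine hq.isQuotientMap.continuous_iff.2 ?_
    convert g.continuous using 1
    funext a
    exact h _ _ (hq.surjective (q a)).choose_spec

lemma descend_apply {q : A → B} (hq : IsOpenQuotientMap q) (g : C(A, Z))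
    (h : ∀ a a', q a = q a' → g a = g a') (a : A) : descend hq g h (q a) = g a :=
  h _ _ (hq.surjective (q a)).choose_spec

/-- A homotopy may be defined before passing to an open quotient. -/
lemma homotopic_of_isOpenQuotientMap {q : A → B} (hq : IsOpenQuotientMap q)
    (H : C(unitInterval × A, Z)) (hH : ∀ t a a', q a = q a' → H (t, a) = H (t, a'))
    {f g : C(B, Z)} (h0 : ∀ a, H (0, a) = f (q a)) (h1 : ∀ a, H (1, a) = g (q a)) :
    f.Homotopic g := by
  have hq' : IsOpenQuotientMap (Prod.map id q : unitInterval × A → unitInterval × B) :=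
    IsOpenQuotientMap.prodMap IsOpenQuotientMap.id hq
  have hH' : ∀ p p' : unitInterval × A, Prod.map id q p = Prod.map id q p' → H p = H p' := by
    rintro ⟨t, a⟩ ⟨t', a'⟩ h
    obtain rfl : t = t' := congrArg Prod.fst h
    exact hH t a a' (congrArg Prod.snd h)
  refine ⟨⟨descend hq' H hH', fun b => ?_, fun b => ?_⟩⟩
  · obtain ⟨a, rfl⟩ := hq.surjective b
    exact (descend_apply hq' H hH' (0, a)).trans (h0 a)
  · obtain ⟨a, rfl⟩ := hq.surjective b
    exact (descend_apply hq' H hH' (1, a)).trans (h1 a)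

end OpenQuotient

section AssocBundle

variable (E F : Type) [NormedAddCommGroup E] [NormedSpace ℂ E] [MulAction ℂˣ F]

/-- The orbits of the diagonal scaling action on a punctured space times a factor. -/
def assocSetoid : Setoid (Punctured E × F) where
  r p q := ∃ c : ℂˣ, q.1.1 = (c : ℂ) • p.1.1 ∧ q.2 = c • p.2
  iseqv :=
    { refl := fun p => ⟨1, by simp, by simp⟩
      symm := by
        rintro p q ⟨c, h1, h2⟩
        refine ⟨c⁻¹, ?_, ?_⟩
        · rw [h1, smul_smul]
          simp
        · rw [h2, smul_smul]
          simp
      trans := by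
        rintro p q r ⟨c, h1, h2⟩ ⟨c', h1', h2'⟩
        refine ⟨c' * c, ?_, ?_⟩
        · rw [h1', h1, smul_smul, Units.val_mul]
        · rw [h2', h2, smul_smul] }

/-- The bundle with fibre `F` over the projectivization of `E` associated to an action of the
multiplicative group on `F`. -/
def AssocBundle : Type := Quotient (assocSetoid E F)

instance [TopologicalSpace F] : TopologicalSpace (AssocBundle E F) :=
  inferInstanceAs (TopologicalSpace (Quotient (assocSetoid E F)))

namespace AssocBundle

variable {E F}

/-- The quotient map. -/
def mk (p : Punctured E × F) : AssocBundle E F := Quotient.mk (assocSetoid E F) p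

lemma mk_eq_mk {p q : Punctured E × F} :
    mk p = mk q ↔ ∃ c : ℂˣ, q.1.1 = (c : ℂ) • p.1.1 ∧ q.2 = c • p.2 :=
  Quotient.eq (r := assocSetoid E F)

lemma mk_surjective : Function.Surjective (mk : Punctured E × F → AssocBundle E F) :=
  Quotient.mk_surjective

variable (E F)

/-- The locus where the first component does not vanish. -/
def fstLocus : Set (AssocBundle (E × ℂ) F) :=
  {x | Quotient.lift (fun p : Punctured (E × ℂ) × F => p.1.1.1 ≠ 0) (by
    rintro p q ⟨c, h, -⟩
    have h' : q.1.1.1 = (c : ℂ) • p.1.1.1 := congrArg Prod.fst h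
    simp [h']) x}

/-- The locus where the second component does not vanish. -/
def sndLocus : Set (AssocBundle (E × ℂ) F) :=
  {x | Quotient.lift (fun p : Punctured (E × ℂ) × F => p.1.1.2 ≠ 0) (by
    rintro p q ⟨c, h, -⟩
    have h' : q.1.1.2 = (c : ℂ) • p.1.1.2 := congrArg Prod.snd h
    simp [h']) x}

variable {E F}

lemma fstLocus_union_sndLocus : fstLocus E F ∪ sndLocus E F = Set.univ := by
  refine Set.eq_univ_of_forall fun x => ?_
  obtain ⟨p, rfl⟩ := mk_surjective x
  by_cases h : p.1.1.1 = 0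
  · exact Or.inr fun h' => p.1.2 (Prod.ext h h')
  · exact Or.inl h

/-- The restriction of the quotient map to a saturated set. -/
abbrev mkRestrict (s : Set (AssocBundle E F)) : mk ⁻¹' s → s := s.restrictPreimage mk

lemma mkRestrict_eq_mkRestrict {s : Set (AssocBundle E F)} {p q : mk ⁻¹' s} :
    mkRestrict s p = mkRestrict s q ↔
      ∃ c : ℂˣ, q.1.1.1 = (c : ℂ) • p.1.1.1 ∧ q.1.2 = c • p.1.2 := by
  rw [← mk_eq_mk]
  exact Subtype.ext_iff

/-- The nonvanishing second component as a unit. -/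
noncomputable def sndUnit (p : mk ⁻¹' sndLocus E F) : ℂˣ := Units.mk0 p.1.1.1.2 p.2

lemma sndUnit_eq {p q : mk ⁻¹' sndLocus E F} {c : ℂˣ} (h : q.1.1.1 = (c : ℂ) • p.1.1.1) :
    sndUnit q = c * sndUnit p :=
  Units.ext (congrArg Prod.snd h)

variable [TopologicalSpace F]

lemma isOpen_fstLocus : IsOpen (fstLocus E F) :=
  isOpen_coinduced.2 (isOpen_ne.preimage
    (f := fun p : Punctured (E × ℂ) × F => p.1.1.1) (by fun_prop))

lemma isOpen_sndLocus : IsOpen (sndLocus E F) :=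
  isOpen_coinduced.2 (isOpen_ne.preimage
    (f := fun p : Punctured (E × ℂ) × F => p.1.1.2) (by fun_prop))

lemma continuous_mk : Continuous (mk : Punctured E × F → AssocBundle E F) :=
  continuous_quotient_mk'

lemma continuous_sndUnit : Continuous (sndUnit : mk ⁻¹' sndLocus E F → ℂˣ) := by
  have h : Continuous fun p : mk ⁻¹' sndLocus E F => (⟨p.1.1.1.2, p.2⟩ : {z : ℂ // z ≠ 0}) := by
    fun_prop
  convert (unitsHomeomorphNeZero (G₀ := ℂ)).symm.continuous.comp h using 1
  funext p
  exact ((unitsHomeomorphNeZero (G₀ := ℂ)).symm_apply_eq.2 rfl).symm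

variable [ContinuousSMul ℂˣ F]

lemma isOpenQuotientMap_mk : IsOpenQuotientMap (mk : Punctured E × F → AssocBundle E F) := by
  refine ⟨mk_surjective, continuous_mk, fun s hs => ?_⟩
  have hopen : IsOpen (mk ⁻¹' (mk '' s) : Set (Punctured E × F)) := by
    have : (mk ⁻¹' (mk '' s) : Set (Punctured E × F)) = ⋃ c : ℂˣ, (fun p : Punctured E × F =>
        ((⟨(c : ℂ) • p.1.1, smul_ne_zero c.ne_zero p.1.2⟩, c • p.2) : Punctured E × F)) ⁻¹' s := by
      ext p
      rw [Set.mem_iUnion]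
      constructor
      · rintro ⟨q, hq, hqp⟩
        obtain ⟨c, h1, h2⟩ := mk_eq_mk.1 hqp.symm
        refine ⟨c, ?_⟩
        have : q = (⟨(c : ℂ) • p.1.1, smul_ne_zero c.ne_zero p.1.2⟩, c • p.2) :=
          Prod.ext (Subtype.ext h1) h2
        rw [this] at hq
        exact hq
      · rintro ⟨c, hc⟩
        exact ⟨_, hc, (mk_eq_mk.2 ⟨c, rfl, rfl⟩).symm⟩
    rw [this]
    exact isOpen_iUnion fun c => hs.preimage (by fun_prop)
  exact isOpen_coinduced.2 hopen

lemma isOpenQuotientMap_mkRestrict (s : Set (AssocBundle E F)) :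
    IsOpenQuotientMap (mkRestrict s) := isOpenQuotientMap_mk.restrictPreimage s

variable (E F)

/-- Forgetting the second component. -/
noncomputable def fstProj : C(fstLocus E F, AssocBundle E F) :=
  descend (isOpenQuotientMap_mkRestrict (fstLocus E F))
    ⟨fun p => mk (⟨p.1.1.1.1, p.2⟩, p.1.2), continuous_mk.comp (by fun_prop)⟩ (by
      intro p q h
      obtain ⟨c, h1, h2⟩ := mkRestrict_eq_mkRestrict.1 h
      exact mk_eq_mk.2 ⟨c, congrArg Prod.fst h1, h2⟩)

variable {E F}

lemma fstProj_mkRestrict (p : mk ⁻¹' fstLocus E F) :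
    fstProj E F (mkRestrict _ p) = mk (⟨p.1.1.1.1, p.2⟩, p.1.2) :=
  descend_apply _ _ _ _

lemma homologyMap_fstProj_bijective (n : ℕ) :
    Function.Bijective (homologyMap (fstProj E F) n) := by
  let g₀ : C(Punctured E × F, mk ⁻¹' fstLocus E F) :=
    ⟨fun p => ⟨(⟨(p.1.1, 0), fun h => p.1.2 (congrArg Prod.fst h)⟩, p.2), p.1.2⟩, by fun_prop⟩
  let g : C(AssocBundle E F, fstLocus E F) := descend isOpenQuotientMap_mk
    ⟨fun p => mkRestrict _ (g₀ p),
      (isOpenQuotientMap_mkRestrict _).continuous.comp g₀.continuous⟩ (by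
      intro p q h
      obtain ⟨c, h1, h2⟩ := mk_eq_mk.1 h
      exact mkRestrict_eq_mkRestrict.2 ⟨c, Prod.ext h1 (by simp [g₀]), h2⟩)
  have hg : ∀ p, g (mk p) = mkRestrict _ (g₀ p) := fun p => descend_apply _ _ _ _
  refine homologyMap_bijective_of_homotopyInverse g ?_ ?_ n
  · have : (fstProj E F).comp g = ContinuousMap.id _ := by
      ext x
      obtain ⟨p, rfl⟩ := mk_surjective x
      rw [ContinuousMap.comp_apply, hg, fstProj_mkRestrict]
      rfl
    rw [this]
  · let H₀ : C(unitInterval × (mk ⁻¹' fstLocus E F : Set (Punctured (E × ℂ) × F)),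
        (mk ⁻¹' fstLocus E F : Set (Punctured (E × ℂ) × F))) :=
      ⟨fun x => ⟨(⟨(x.2.1.1.1.1, ((x.1 : ℝ) : ℂ) * x.2.1.1.1.2),
        fun h => x.2.2 (congrArg Prod.fst h)⟩, x.2.1.2), x.2.2⟩, by fun_prop⟩
    refine homotopic_of_isOpenQuotientMap (isOpenQuotientMap_mkRestrict _)
      ⟨fun x => mkRestrict _ (H₀ x),
        (isOpenQuotientMap_mkRestrict _).continuous.comp H₀.continuous⟩ ?_ ?_ ?_
    · intro t p q h
      obtain ⟨c, h1, h2⟩ := mkRestrict_eq_mkRestrict.1 h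
      refine mkRestrict_eq_mkRestrict.2 ⟨c, Prod.ext (congrArg Prod.fst h1 :) ?_, h2⟩
      have h3 : q.1.1.1.2 = (c : ℂ) * p.1.1.1.2 := congrArg Prod.snd h1
      change (((t : ℝ) : ℂ) * q.1.1.1.2) = (c : ℂ) * (((t : ℝ) : ℂ) * p.1.1.1.2)
      rw [h3]
      ring
    · intro p
      rw [ContinuousMap.comp_apply, fstProj_mkRestrict, hg]
      refine congrArg (mkRestrict _) (Subtype.ext (Prod.ext (Subtype.ext (Prod.ext rfl ?_)) rfl))
      change (((0 : unitInterval) : ℝ) : ℂ) * p.1.1.1.2 = 0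
      simp
    · intro p
      refine congrArg (mkRestrict _) (Subtype.ext (Prod.ext (Subtype.ext (Prod.ext rfl ?_)) rfl))
      change (((1 : unitInterval) : ℝ) : ℂ) * p.1.1.1.2 = p.1.1.1.2
      simp

variable (E F)

/-- The fibre coordinate where the second component does not vanish. -/
noncomputable def sndProj : C(sndLocus E F, F) :=
  descend (isOpenQuotientMap_mkRestrict (sndLocus E F))
    ⟨fun p => (sndUnit p)⁻¹ • p.1.2, continuous_sndUnit.inv.smul (by fun_prop)⟩ (by
      intro p q h
      obtain ⟨c, h1, h2⟩ := mkRestrict_eq_mkRestrict.1 h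
      change (sndUnit p)⁻¹ • p.1.2 = (sndUnit q)⁻¹ • q.1.2
      rw [sndUnit_eq h1, h2, smul_smul]
      simp)

variable {E F}

lemma sndProj_mkRestrict (p : mk ⁻¹' sndLocus E F) :
    sndProj E F (mkRestrict _ p) = (sndUnit p)⁻¹ • p.1.2 :=
  descend_apply _ _ _ _

lemma homologyMap_sndProj_bijective (n : ℕ) :
    Function.Bijective (homologyMap (sndProj E F) n) := by
  let g₀ : C(F, mk ⁻¹' sndLocus E F) :=
    ⟨fun f => ⟨(⟨(0, 1), fun h => one_ne_zero (congrArg Prod.snd h)⟩, f),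
      (one_ne_zero : (1 : ℂ) ≠ 0)⟩, by fun_prop⟩
  let g : C(F, sndLocus E F) := ⟨fun f => mkRestrict _ (g₀ f),
      (isOpenQuotientMap_mkRestrict _).continuous.comp g₀.continuous⟩
  have hg₀ : ∀ f, sndUnit (g₀ f) = 1 := fun f => Units.ext rfl
  refine homologyMap_bijective_of_homotopyInverse g ?_ ?_ n
  · have : (sndProj E F).comp g = ContinuousMap.id _ := by
      ext f
      change sndProj E F (mkRestrict _ (g₀ f)) = f
      rw [sndProj_mkRestrict, hg₀, inv_one, one_smul]
      rfl
    rw [this]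
  · let H₀ : C(unitInterval × (mk ⁻¹' sndLocus E F : Set (Punctured (E × ℂ) × F)),
        (mk ⁻¹' sndLocus E F : Set (Punctured (E × ℂ) × F))) :=
      ⟨fun x => ⟨(⟨(((x.1 : ℝ) : ℂ) • x.2.1.1.1.1, x.2.1.1.1.2),
        fun h => x.2.2 (congrArg Prod.snd h)⟩, x.2.1.2), x.2.2⟩, by fun_prop⟩
    refine homotopic_of_isOpenQuotientMap (isOpenQuotientMap_mkRestrict _)
      ⟨fun x => mkRestrict _ (H₀ x),
        (isOpenQuotientMap_mkRestrict _).continuous.comp H₀.continuous⟩ ?_ ?_ ?_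
    · intro t p q h
      obtain ⟨c, h1, h2⟩ := mkRestrict_eq_mkRestrict.1 h
      refine mkRestrict_eq_mkRestrict.2 ⟨c, Prod.ext ?_ (congrArg Prod.snd h1 :), h2⟩
      have h3 : q.1.1.1.1 = (c : ℂ) • p.1.1.1.1 := congrArg Prod.fst h1
      change (((t : ℝ) : ℂ) • q.1.1.1.1) = (c : ℂ) • (((t : ℝ) : ℂ) • p.1.1.1.1)
      rw [h3, smul_comm]
    · intro p
      rw [ContinuousMap.comp_apply, sndProj_mkRestrict]
      refine mkRestrict_eq_mkRestrict.2 ⟨(sndUnit p)⁻¹, Prod.ext ?_ ?_, rfl⟩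
      · change (0 : E) = _ • ((((0 : unitInterval) : ℝ) : ℂ) • p.1.1.1.1)
        simp
      · exact (inv_mul_cancel₀ (a := p.1.1.1.2) p.2).symm
    · intro p
      refine congrArg (mkRestrict _) (Subtype.ext (Prod.ext (Subtype.ext (Prod.ext ?_ rfl)) rfl))
      change (((1 : unitInterval) : ℝ) : ℂ) • p.1.1.1.1 = p.1.1.1.1
      simp

variable (E F)

/-- The trivialization of the intersection of the two loci. -/
noncomputable def interIncl : C(Punctured E × F, (fstLocus E F ∩ sndLocus E F : Set _)) :=
  ⟨fun p => mkRestrict (fstLocus E F ∩ sndLocus E F)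
    ⟨(⟨(p.1.1, 1), fun h => p.1.2 (congrArg Prod.fst h)⟩, p.2),
      p.1.2, (one_ne_zero : (1 : ℂ) ≠ 0)⟩,
    (isOpenQuotientMap_mkRestrict _).continuous.comp (by fun_prop)⟩

variable {E F}

lemma homologyMap_interIncl_bijective (n : ℕ) :
    Function.Bijective (homologyMap (interIncl E F) n) := by
  let j : C(mk ⁻¹' (fstLocus E F ∩ sndLocus E F), mk ⁻¹' sndLocus E F) :=
    inclusionMap fun _ hp => hp.2
  let g : C((fstLocus E F ∩ sndLocus E F : Set _), Punctured E × F) :=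
    descend (isOpenQuotientMap_mkRestrict _)
      ⟨fun p => (⟨((sndUnit (j p))⁻¹ : ℂˣ).val • p.1.1.1.1,
        smul_ne_zero (Units.ne_zero _) p.2.1⟩, (sndUnit (j p))⁻¹ • p.1.2), by
        have h1 : Continuous fun p => (sndUnit (j p))⁻¹ :=
          (continuous_sndUnit.comp j.continuous).inv
        have h2 : Continuous fun p => (((sndUnit (j p))⁻¹ : ℂˣ) : ℂ) :=
          Units.continuous_val.comp h1
        exact (Continuous.subtype_mk (h2.smul (by fun_prop)) _).prodMk (h1.smul (by fun_prop))⟩ (by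
        intro p q h
        obtain ⟨c, h1, h2⟩ := mkRestrict_eq_mkRestrict.1 h
        have h3 : sndUnit (j q) = c * sndUnit (j p) := sndUnit_eq h1
        have h4 : q.1.1.1.1 = (c : ℂ) • p.1.1.1.1 := congrArg Prod.fst h1
        refine Prod.ext (Subtype.ext ?_) ?_
        · change ((sndUnit (j p))⁻¹ : ℂˣ).val • p.1.1.1.1 =
            ((sndUnit (j q))⁻¹ : ℂˣ).val • q.1.1.1.1
          rw [h3, h4, smul_smul, ← Units.val_mul]
          simp
        · change (sndUnit (j p))⁻¹ • p.1.2 = (sndUnit (j q))⁻¹ • q.1.2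
          rw [h3, h2, smul_smul]
          simp)
  have hg : ∀ p, g (mkRestrict _ p) = (⟨((sndUnit (j p))⁻¹ : ℂˣ).val • p.1.1.1.1,
        smul_ne_zero (Units.ne_zero _) p.2.1⟩, (sndUnit (j p))⁻¹ • p.1.2) :=
    fun p => descend_apply _ _ _ _
  refine homologyMap_bijective_of_homotopyInverse g ?_ ?_ n
  · have : (interIncl E F).comp g = ContinuousMap.id _ := by
      ext1 x
      obtain ⟨p, rfl⟩ := (isOpenQuotientMap_mkRestrict _).surjective x
      rw [ContinuousMap.comp_apply, hg]
      refine mkRestrict_eq_mkRestrict.2 ⟨sndUnit (j p), Prod.ext ?_ ?_, ?_⟩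
      · change p.1.1.1.1 = (sndUnit (j p)).val • ((sndUnit (j p))⁻¹ : ℂˣ).val • p.1.1.1.1
        rw [smul_smul, ← Units.val_mul]
        simp
      · exact (mul_one p.1.1.1.2).symm
      · change p.1.2 = sndUnit (j p) • (sndUnit (j p))⁻¹ • p.1.2
        rw [smul_inv_smul]
    rw [this]
  · have : g.comp (interIncl E F) = ContinuousMap.id _ := by
      ext1 p
      refine (hg _).trans ?_
      have h1 : ∀ h, sndUnit (⟨(⟨(p.1.1, 1), fun h => p.1.2 (congrArg Prod.fst h)⟩, p.2), h⟩ :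
        mk ⁻¹' sndLocus E F) = 1 := fun h => Units.ext rfl
      refine Prod.ext (Subtype.ext ?_) ?_
      · change ((sndUnit _)⁻¹ : ℂˣ).val • p.1.1 = p.1.1
        erw [h1]
        simp
      · change (sndUnit _)⁻¹ • p.2 = p.2
        erw [h1]
        simp
    rw [this]

end AssocBundle

end AssocBundle

section Polynomial

open Polynomial

namespace AssocBundle

section Betti

variable {E F : Type} [NormedAddCommGroup E] [NormedSpace ℂ E] [MulAction ℂˣ F]
  [TopologicalSpace F] [ContinuousSMul ℂˣ F]

/-- The quotient map, bundled. -/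
def mkMap (E F : Type) [NormedAddCommGroup E] [NormedSpace ℂ E] [MulAction ℂˣ F]
    [TopologicalSpace F] : C(Punctured E × F, AssocBundle E F) := ⟨mk, continuous_mk⟩

lemma finrank_rationalHomology_prod
    (hF : ∀ n, Module.Finite ℚ (rationalHomology F n))
    (hA : ∀ n, Module.Finite ℚ (rationalHomology (AssocBundle E F) n))
    (hC : ∀ n, Module.Finite ℚ (rationalHomology (Punctured E × F) n)) :
    (∀ n, Module.Finite ℚ (rationalHomology (AssocBundle (E × ℂ) F) n)) ∧
    (Module.finrank ℚ (rationalHomology (AssocBundle (E × ℂ) F) 0) +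
        Module.finrank ℚ (LinearMap.range ((homologyMap (mkMap E F) 0).prod
          (homologyMap (sndMap (Punctured E) F) 0))) =
      Module.finrank ℚ (rationalHomology (AssocBundle E F) 0) +
        Module.finrank ℚ (rationalHomology F 0)) ∧
    ∀ n, Module.finrank ℚ (rationalHomology (AssocBundle (E × ℂ) F) (n + 1)) +
        Module.finrank ℚ (LinearMap.range ((homologyMap (mkMap E F) (n + 1)).prod
          (homologyMap (sndMap (Punctured E) F) (n + 1)))) =
      Module.finrank ℚ (rationalHomology (AssocBundle E F) (n + 1)) +
        Module.finrank ℚ (rationalHomology F (n + 1)) +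
        Module.finrank ℚ (LinearMap.ker ((homologyMap (mkMap E F) n).prod
          (homologyMap (sndMap (Punctured E) F) n))) := by
  refine finrank_rationalHomology_of_cover isOpen_fstLocus isOpen_sndLocus
    fstLocus_union_sndLocus (fstProj E F) (sndProj E F) (interIncl E F)
    homologyMap_fstProj_bijective homologyMap_sndProj_bijective homologyMap_interIncl_bijective
    (mkMap E F) (sndMap _ _) ?_ ?_ hA hF hC
  · ext1 p
    exact fstProj_mkRestrict
      ⟨(⟨(p.1.1, 1), fun h => p.1.2 (congrArg Prod.fst h)⟩, p.2), p.1.2⟩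
  · ext1 p
    refine (sndProj_mkRestrict
      ⟨(⟨(p.1.1, 1), fun h => p.1.2 (congrArg Prod.fst h)⟩, p.2), one_ne_zero⟩).trans ?_
    rw [show sndUnit (_ : mk ⁻¹' sndLocus E F) = 1 from Units.ext rfl, inv_one, one_smul]
    rfl

lemma isPoincarePolynomial_prod [FiniteDimensional ℂ E] {P Q : ℤ[X]}
    (hP : IsPoincarePolynomial F P) (hPodd : ∀ k, P.coeff (2 * k + 1) = 0)
    (hQ : IsPoincarePolynomial (AssocBundle E F) Q) (hQodd : ∀ k, Q.coeff (2 * k + 1) = 0) :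
    IsPoincarePolynomial (AssocBundle (E × ℂ) F)
      (Q + X ^ (2 * Module.finrank ℂ E) * P) := by
  rcases Nat.eq_zero_or_pos (Module.finrank ℂ E) with hn | hn
  · have : Subsingleton E := Module.finrank_zero_iff.1 hn
    have : IsEmpty (Punctured E) := ⟨fun x => x.2 (Subsingleton.elim _ _)⟩
    have hs := fun n => subsingleton_rationalHomology_of_isEmpty (X := Punctured E × F) n
    obtain ⟨h1, h2, h3⟩ := finrank_rationalHomology_prod (E := E) (fun n => (hP n).1)
      (fun n => (hQ n).1) (fun n => inferInstance)
    have hr : ∀ n, Module.finrank ℚ (LinearMap.range ((homologyMap (mkMap E F) n).prod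
          (homologyMap (sndMap (Punctured E) F) n))) = 0 := fun n => by
      rw [LinearMap.range_eq_bot.2 (LinearMap.ext fun x => by
        rw [(hs n).elim x 0, map_zero, map_zero]), finrank_bot]
    have hk : ∀ n, Module.finrank ℚ (LinearMap.ker ((homologyMap (mkMap E F) n).prod
          (homologyMap (sndMap (Punctured E) F) n))) = 0 := fun n =>
      Module.finrank_zero_of_subsingleton
    intro k
    refine ⟨h1 k, ?_⟩
    rw [hn, mul_zero, pow_zero, one_mul, coeff_add, (hP k).2, (hQ k).2]
    cases k with
    | zero =>
      rw [hr] at h2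
      exact_mod_cast h2.symm
    | succ k =>
      have h3' := h3 k
      rw [hr, hk] at h3'
      exact_mod_cast h3'.symm
  · obtain ⟨m, hm⟩ : ∃ m, Module.finrank ℂ E = m + 1 := ⟨_, (Nat.sub_add_cancel hn).symm⟩
    have hC := isPoincarePolynomial_punctured_prod hP (2 * m + 1) E
      (by rw [finrank_real_of_complex, hm]; ring)
    have : Nontrivial E := Module.nontrivial_of_finrank_pos hn
    have : Nonempty (Punctured E) := by
      obtain ⟨x, hx⟩ := exists_ne (0 : E)
      exact ⟨⟨x, hx⟩⟩
    have hfP := fun n => (hP n).1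
    have hfQ := fun n => (hQ n).1
    have hfC := fun n => (hC n).1
    obtain ⟨h1, h2, h3⟩ := finrank_rationalHomology_prod (E := E) hfP hfQ hfC
    set f := fun n => (homologyMap (mkMap E F) n).prod (homologyMap (sndMap (Punctured E) F) n)
      with hf
    have hsum : ∀ n, Module.finrank ℚ (LinearMap.range (f n)) +
        Module.finrank ℚ (LinearMap.ker (f n)) =
          Module.finrank ℚ (rationalHomology (Punctured E × F) n) := fun n =>
      LinearMap.finrank_range_add_finrank_ker (f n)
    have hCn : ∀ n, (Module.finrank ℚ (rationalHomology (Punctured E × F) n) : ℤ) =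
        P.coeff n + (X ^ (2 * m + 1) * P).coeff n := fun n => by
      rw [← (hC n).2, add_mul, one_mul, coeff_add]
    have heven : ∀ k, Module.finrank ℚ (LinearMap.ker (f (2 * k))) = 0 := fun k => by
      have h4 := LinearMap.finrank_range_add_finrank_ker
        (homologyMap (sndMap (Punctured E) F) (2 * k))
      rw [LinearMap.range_eq_top.2 (homologyMap_sndMap_surjective (2 * k)), finrank_top] at h4
      have h5 : LinearMap.ker (f (2 * k)) ≤
          LinearMap.ker (homologyMap (sndMap (Punctured E) F) (2 * k)) := by
        rw [hf, LinearMap.ker_prod]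
        exact inf_le_right
      have h6 := Submodule.finrank_mono h5
      have h7 := hCn (2 * k)
      have h8 : (X ^ (2 * m + 1) * P).coeff (2 * k) = 0 := by
        rw [coeff_X_pow_mul']
        split_ifs with h
        · rw [show 2 * k - (2 * m + 1) = 2 * (k - m - 1) + 1 by omega]
          exact hPodd _
        · rfl
      rw [h8, add_zero, (hP (2 * k)).2] at h7
      omega
    have hodd : ∀ k, Module.finrank ℚ (LinearMap.range (f (2 * k + 1))) = 0 := fun k => by
      have h4 := (hP (2 * k + 1)).2
      have h5 := (hQ (2 * k + 1)).2
      rw [hPodd] at h4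
      rw [hQodd] at h5
      have h6 := Submodule.finrank_le (LinearMap.range (f (2 * k + 1)))
      rw [Module.finrank_prod] at h6
      omega
    have hX : ∀ i j, (X ^ (2 * i + 1) * P).coeff (2 * j) = 0 := fun i j => by
      rw [coeff_X_pow_mul']
      split_ifs with h
      · rw [show 2 * j - (2 * i + 1) = 2 * (j - i - 1) + 1 by omega]
        exact hPodd _
      · rfl
    have h2' : Module.finrank ℚ (rationalHomology (AssocBundle (E × ℂ) F) 0) +
        Module.finrank ℚ (LinearMap.range (f 0)) =
        Module.finrank ℚ (rationalHomology (AssocBundle E F) 0) +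
          Module.finrank ℚ (rationalHomology F 0) := h2
    have h3' : ∀ n, Module.finrank ℚ (rationalHomology (AssocBundle (E × ℂ) F) (n + 1)) +
        Module.finrank ℚ (LinearMap.range (f (n + 1))) =
        Module.finrank ℚ (rationalHomology (AssocBundle E F) (n + 1)) +
          Module.finrank ℚ (rationalHomology F (n + 1)) +
          Module.finrank ℚ (LinearMap.ker (f n)) := h3
    have hsum' : ∀ j, (Module.finrank ℚ (LinearMap.range (f (2 * j))) : ℤ) =
        Module.finrank ℚ (rationalHomology F (2 * j)) := fun j => by
      have e1 := hsum (2 * j)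
      have e2 := heven j
      have e3 := hCn (2 * j)
      rw [hX, add_zero, (hP (2 * j)).2] at e3
      omega
    intro k
    refine ⟨h1 k, ?_⟩
    rw [coeff_add, (hQ k).2, hm]
    rcases Nat.even_or_odd' k with ⟨j, rfl | rfl⟩
    · cases j with
      | zero =>
        have e1 : (Module.finrank ℚ (LinearMap.range (f 0)) : ℤ) =
          Module.finrank ℚ (rationalHomology F 0) := hsum' 0
        rw [coeff_X_pow_mul', if_neg (by omega), mul_zero]
        omega
      | succ j =>
        have e1 : (Module.finrank ℚ (LinearMap.range (f (2 * j + 1 + 1))) : ℤ) =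
          Module.finrank ℚ (rationalHomology F (2 * j + 1 + 1)) := hsum' (j + 1)
        have e5 := h3' (2 * j + 1)
        have e6 := hsum (2 * j + 1)
        have e7 := hodd j
        have e8 := hCn (2 * j + 1)
        rw [hPodd, zero_add] at e8
        rw [show 2 * (m + 1) = 2 * m + 1 + 1 by ring, pow_succ, mul_assoc, mul_comm X, ← mul_assoc,
          show 2 * (j + 1) = 2 * j + 1 + 1 by ring, coeff_mul_X, ← e8]
        omega
    · have e1 := h3' (2 * j)
      have e2 := hodd j
      have e3 := heven j
      have e4 := (hP (2 * j + 1)).2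
      have e5 := (hQ (2 * j + 1)).2
      rw [hPodd] at e4
      rw [hQodd] at e5
      have e6 : (X ^ (2 * (m + 1)) * P).coeff (2 * j + 1) = 0 := by
        rw [coeff_X_pow_mul']
        split_ifs with h
        · rw [show 2 * j + 1 - 2 * (m + 1) = 2 * (j - m - 1) + 1 by omega]
          exact hPodd _
        · rfl
      rw [e6]
      omega

end Betti

section Congr

variable {E E' F F' : Type} [NormedAddCommGroup E] [NormedSpace ℂ E] [NormedAddCommGroup E']
  [NormedSpace ℂ E'] [MulAction ℂˣ F]

/-- A linear homeomorphism induces a map of associated bundles. -/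
def mapLinear (e : E ≃L[ℂ] E') : AssocBundle E F → AssocBundle E' F :=
  Quotient.map (fun p => (⟨e p.1.1, by simpa using p.1.2⟩, p.2)) (by
    rintro p q ⟨c, h1, h2⟩
    exact ⟨c, (congrArg e h1).trans (map_smul e _ _), h2⟩)

lemma mapLinear_symm_mapLinear (e : E ≃L[ℂ] E') (x : AssocBundle E F) :
    mapLinear e.symm (mapLinear e x) = x := by
  obtain ⟨p, rfl⟩ := mk_surjective x
  exact congrArg mk (Prod.ext (Subtype.ext (e.symm_apply_apply _)) rfl)

variable [TopologicalSpace F]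

lemma continuous_mapLinear (e : E ≃L[ℂ] E') :
    Continuous (mapLinear e : AssocBundle E F → AssocBundle E' F) :=
  Continuous.quotient_map' (by fun_prop) _

/-- A linear homeomorphism induces a homeomorphism of associated bundles. -/
def congrLinear (e : E ≃L[ℂ] E') : AssocBundle E F ≃ₜ AssocBundle E' F where
  toFun := mapLinear e
  invFun := mapLinear e.symm
  left_inv := mapLinear_symm_mapLinear e
  right_inv := mapLinear_symm_mapLinear e.symm
  continuous_toFun := continuous_mapLinear e
  continuous_invFun := continuous_mapLinear e.symm

end Congr

lemma coeff_sum_pow_mul_odd (n : ℕ) {P : ℤ[X]} (h : ∀ k, P.coeff (2 * k + 1) = 0) (k : ℕ) :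
    ((∑ i ∈ Finset.range n, X ^ (2 * i)) * P).coeff (2 * k + 1) = 0 := by
  rw [Finset.sum_mul, finsetSum_coeff]
  refine Finset.sum_eq_zero fun i _ => ?_
  rw [coeff_X_pow_mul']
  split_ifs with hi
  · rw [show 2 * k + 1 - 2 * i = 2 * (k - i) + 1 by omega]
    exact h _
  · rfl

/-- The Poincaré polynomial of a bundle over a projective space, associated to an action on a
fibre whose homology vanishes in odd degrees. -/
theorem isPoincarePolynomial {F : Type} [MulAction ℂˣ F] [TopologicalSpace F]
    [ContinuousSMul ℂˣ F] {P : ℤ[X]} (hP : IsPoincarePolynomial F P)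
    (hodd : ∀ k, P.coeff (2 * k + 1) = 0) :
    ∀ (n : ℕ) (E : Type) [NormedAddCommGroup E] [NormedSpace ℂ E] [FiniteDimensional ℂ E],
      Module.finrank ℂ E = n →
      IsPoincarePolynomial (AssocBundle E F) ((∑ i ∈ Finset.range n, X ^ (2 * i)) * P) := by
  intro n
  induction n with
  | zero =>
    intro E _ _ _ hE
    have : Subsingleton E := Module.finrank_zero_iff.1 hE
    have : IsEmpty (AssocBundle E F) :=
      ⟨fun x => (mk_surjective x).elim fun p _ => p.1.2 (Subsingleton.elim _ _)⟩
    rw [Finset.sum_range_zero, zero_mul]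
    exact isPoincarePolynomial_of_isEmpty
  | succ n ih =>
    intro E _ _ _ hE
    have e : ((Fin n → ℂ) × ℂ) ≃L[ℂ] E := ContinuousLinearEquiv.ofFinrankEq (by simp [hE])
    refine IsPoincarePolynomial.of_homeomorph ?_ (congrLinear e)
    have h := isPoincarePolynomial_prod (E := Fin n → ℂ) hP hodd (ih _ (by simp))
      (coeff_sum_pow_mul_odd n hodd)
    rw [Finset.sum_range_succ, add_mul]
    simpa using h

end AssocBundle

end Polynomial

/-! ### Representations with one-dimensional spaces -/

section Representations

variable {l : Matrix (Fin 3) (Fin 3) ℕ} {ζ : Fin 3 → ℝ}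

lemma finrank_ite_top_bot (p : Prop) [Decidable p] :
    Module.finrank ℂ (if p then ⊤ else ⊥ : Submodule ℂ (Fin 1 → ℂ)) = if p then 1 else 0 := by
  by_cases h : p
  · rw [if_pos h, if_pos h, finrank_top, Module.finrank_fin_fun]
  · rw [if_neg h, if_neg h, finrank_bot]

lemma eq_bot_or_eq_top_of_fin_one (W : Submodule ℂ (Fin 1 → ℂ)) : W = ⊥ ∨ W = ⊤ := by
  have h : Module.finrank ℂ W ≤ 1 := by simpa using Submodule.finrank_le W
  interval_cases h' : Module.finrank ℂ W
  · exact Or.inl (Submodule.finrank_eq_zero.1 h')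
  · exact Or.inr (Submodule.eq_top_of_finrank_eq (by simpa using h'))

lemma quiverSlope_one (h : ζ 0 + ζ 1 + ζ 2 = 0) : quiverSlope ζ (fun _ => 1) = 0 := by
  simp [quiverSlope, Fin.sum_univ_three, h]

/-- If no arrow leaving a vertex acts nontrivially, then the vertex spans a subrepresentation. -/
lemma IsStableRep.neg_of_forall_eq_zero (h : ζ 0 + ζ 1 + ζ 2 = 0)
    {f : QuiverRep l (fun _ => 1)} (hf : IsStableRep ζ f) {k : Fin 3}
    (hk : ∀ i a, f i k a = 0) : ζ k < 0 := by
  have hlt := hf.2 (fun v => if v = k then ⊤ else ⊥) ?_ ?_ ?_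
  · rw [quiverSlope_one h] at hlt
    simpa only [quiverSlope, finrank_ite_top_bot, Nat.cast_ite, Nat.cast_one, Nat.cast_zero,
      mul_ite, mul_one, mul_zero, Finset.sum_ite_eq', Finset.mem_univ, if_true, div_one] using hlt
  · intro i j a x hx
    by_cases hj : j = k
    · subst hj
      rw [hk, Matrix.zero_mulVec]
      exact zero_mem _
    · simp only [if_neg hj, Submodule.mem_bot] at hx
      rw [hx, Matrix.mulVec_zero]
      exact zero_mem _
  · intro h0
    have := congrFun h0 k
    simp at this
  · intro h0
    have := congrFun h0 (k + 1)
    simp at this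

lemma IsSubrep.ne_bot {f : QuiverRep l (fun _ => 1)}
    {U : ∀ _ : Fin 3, Submodule ℂ (Fin 1 → ℂ)} (hU : IsSubrep f U) {i j : Fin 3}
    (hj : U j = ⊤) (hf : (fun a => f i j a 0 0) ≠ 0) : U i ≠ ⊥ := by
  intro hi
  refine hf (funext fun a => ?_)
  have h : f i j a *ᵥ (fun _ => 1) ∈ U i := hU i j a _ (hj ▸ Submodule.mem_top)
  rw [hi, Submodule.mem_bot] at h
  simpa [Matrix.mulVec, dotProduct] using congrFun h 0

lemma matrix_eq_zero_of_apply_eq_zero {i j : Fin 3} {f : QuiverRep l (fun _ => 1)}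
    (h : (fun a => f i j a 0 0) = 0) (a : Fin (l i j)) : f i j a = 0 := by
  ext p q
  rw [Subsingleton.elim p 0, Subsingleton.elim q 0]
  exact congrFun h a

lemma isStableRep_iff (hl : ∀ i j, j ≤ i → l i j = 0) (h : ζ 0 + ζ 1 + ζ 2 = 0) (h1 : 0 < ζ 1) (h2 : 0 < ζ 2)
    (f : QuiverRep l (fun _ => 1)) :
    IsStableRep ζ f ↔ (fun a => f 0 1 a 0 0) ≠ 0 ∧
      ((fun a => f 0 2 a 0 0, fun a => f 1 2 a 0 0) :
        (Fin (l 0 2) → ℂ) × (Fin (l 1 2) → ℂ)) ≠ 0 := by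
  have hempty : ∀ i j : Fin 3, j ≤ i → ∀ a, f i j a = 0 := fun i j hij a =>
    (Fin.cast (hl i j hij) a).elim0
  constructor
  · intro hf
    refine ⟨fun h0 => ?_, fun h0 => ?_⟩
    · refine lt_asymm h1 (hf.neg_of_forall_eq_zero h fun i => ?_)
      fin_cases i
      · exact matrix_eq_zero_of_apply_eq_zero h0
      · exact hempty 1 1 (by decide)
      · exact hempty 2 1 (by decide)
    · refine lt_asymm h2 (hf.neg_of_forall_eq_zero h fun i => ?_)
      fin_cases i
      · exact matrix_eq_zero_of_apply_eq_zero (congrArg Prod.fst h0)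
      · exact matrix_eq_zero_of_apply_eq_zero (congrArg Prod.snd h0)
      · exact hempty 2 2 (by decide)
  · rintro ⟨ha, hb⟩
    refine ⟨fun h0 => one_ne_zero (congrFun h0 0), fun U hU hbot htop => ?_⟩
    rw [quiverSlope_one h]
    have hb' : (fun a => f 0 2 a 0 0) ≠ 0 ∨ (fun a => f 1 2 a 0 0) ≠ 0 := by
      by_contra! h0
      exact hb (Prod.ext h0.1 h0.2)
    have ht : ∀ v, U v = ⊤ → Module.finrank ℂ (U v) = 1 := fun v hv => by
      rw [hv, finrank_top, Module.finrank_fin_fun]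
    have hz : ∀ v, U v = ⊥ → Module.finrank ℂ (U v) = 0 := fun v hv => by rw [hv, finrank_bot]
    rcases eq_bot_or_eq_top_of_fin_one (U 0) with h0 | h0
    · rcases eq_bot_or_eq_top_of_fin_one (U 1) with h1' | h1'
      · rcases eq_bot_or_eq_top_of_fin_one (U 2) with h2' | h2'
        · refine absurd (funext fun v => ?_) hbot
          fin_cases v
          exacts [h0, h1', h2']
        · exact (hb'.elim (fun h3 => hU.ne_bot h2' h3 h0) fun h3 => hU.ne_bot h2' h3 h1').elim
      · exact (hU.ne_bot h1' ha h0).elim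
    · rcases eq_bot_or_eq_top_of_fin_one (U 1) with h1' | h1' <;>
        rcases eq_bot_or_eq_top_of_fin_one (U 2) with h2' | h2'
      · simp only [quiverSlope, Fin.sum_univ_three, ht 0 h0, hz 1 h1', hz 2 h2']
        norm_num
        linarith
      · simp only [quiverSlope, Fin.sum_univ_three, ht 0 h0, hz 1 h1', ht 2 h2']
        norm_num
        rw [div_lt_iff₀ (by norm_num)]
        linarith
      · simp only [quiverSlope, Fin.sum_univ_three, ht 0 h0, ht 1 h1', hz 2 h2']
        norm_num
        rw [div_lt_iff₀ (by norm_num)]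
        linarith
      · refine absurd (funext fun v => ?_) htop
        fin_cases v
        exacts [h0, h1', h2']

lemma stableRepSetoid_one_iff {f f' : {f : QuiverRep l (fun _ => 1) // IsStableRep ζ f}} :
    stableRepSetoid l _ ζ f f' ↔
      ∃ c : Fin 3 → ℂˣ, ∀ i j a, f'.1 i j a 0 0 = c i * f.1 i j a 0 0 * ((c j)⁻¹ : ℂˣ) := by
  constructor
  · rintro ⟨g, hg⟩
    refine ⟨fun v => Matrix.GeneralLinearGroup.det (g v), fun i j a => ?_⟩
    rw [hg, ← map_inv]
    simp [Matrix.mul_apply, -Matrix.coe_units_inv, -map_inv]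
  · rintro ⟨c, hc⟩
    refine ⟨fun v => Units.map (Matrix.scalar (Fin 1)).toMonoidHom (c v), fun i j a => ?_⟩
    ext p q
    rw [Subsingleton.elim p 0, Subsingleton.elim q 0, hc, ← map_inv]
    simp [Matrix.mul_apply, -Matrix.coe_units_inv, -map_inv]

end Representations

/-- Two quotient maps with the same fibres have homeomorphic targets. -/
lemma nonempty_homeomorph_of_isQuotientMap {X A B : Type} [TopologicalSpace X]
    [TopologicalSpace A] [TopologicalSpace B] {p : X → A} {q : X → B}
    (hp : Topology.IsQuotientMap p) (hq : Topology.IsQuotientMap q)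
    (h : ∀ x y, p x = p y ↔ q x = q y) : Nonempty (A ≃ₜ B) := by
  have hk : Setoid.ker p = Setoid.ker q := Setoid.ext h
  have e : Quotient (Setoid.ker p) ≃ₜ A :=
    Topology.IsQuotientMap.homeomorph (f := ⟨p, hp.continuous⟩) hp
  rw [hk] at e
  exact ⟨e.symm.trans (Topology.IsQuotientMap.homeomorph (f := ⟨q, hq.continuous⟩) hq)⟩

/-! ### Scaling one summand of a projective space -/

section ScaledProj

variable (A B : Type) [NormedAddCommGroup A] [NormedSpace ℂ A] [NormedAddCommGroup B]
  [NormedSpace ℂ B]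

/-- The projectivization of a direct sum, with the inverse scaling action on the second summand. -/
def ScaledProj : Type := AssocBundle (A × B) PUnit.{1}

instance : TopologicalSpace (ScaledProj A B) :=
  inferInstanceAs (TopologicalSpace (AssocBundle (A × B) PUnit.{1}))

variable {A B}

/-- The inverse scaling of the second summand. -/
noncomputable def sndScale (c : ℂˣ) (p : Punctured (A × B)) : Punctured (A × B) :=
  ⟨(p.1.1, ((c⁻¹ : ℂˣ) : ℂ) • p.1.2), fun h => p.2 (Prod.ext (congrArg Prod.fst h :)
    ((smul_eq_zero.1 (congrArg Prod.snd h :)).resolve_left (Units.ne_zero _)))⟩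

namespace ScaledProj

/-- The point with given homogeneous coordinates. -/
noncomputable def mk (p : Punctured (A × B)) : ScaledProj A B := AssocBundle.mk (p, PUnit.unit)

lemma mk_eq_mk {p q : Punctured (A × B)} : mk p = mk q ↔ ∃ c : ℂˣ, q.1 = (c : ℂ) • p.1 :=
  AssocBundle.mk_eq_mk.trans (by simp)

lemma mk_surjective : Function.Surjective (mk : Punctured (A × B) → ScaledProj A B) := fun x =>
  (AssocBundle.mk_surjective x).elim fun p h => ⟨p.1, h⟩

noncomputable instance : SMul ℂˣ (ScaledProj A B) where
  smul c := Quotient.map (fun p => (sndScale c p.1, PUnit.unit)) (by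
    rintro p q ⟨b, h, -⟩
    refine ⟨b, ?_, rfl⟩
    simp only [sndScale, h]
    exact Prod.ext rfl (smul_comm _ _ _))

lemma smul_mk (c : ℂˣ) (p : Punctured (A × B)) : c • mk p = mk (sndScale c p) := rfl

noncomputable instance : MulAction ℂˣ (ScaledProj A B) where
  one_smul x := by
    obtain ⟨p, rfl⟩ := mk_surjective x
    rw [smul_mk]
    congr 1
    exact Subtype.ext (Prod.ext rfl (by simp [sndScale]))
  mul_smul b c x := by
    obtain ⟨p, rfl⟩ := mk_surjective x
    rw [smul_mk, smul_mk, smul_mk]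
    congr 1
    exact Subtype.ext (Prod.ext rfl (by simp [sndScale, smul_smul, mul_comm]))

lemma isOpenQuotientMap_mk :
    IsOpenQuotientMap (mk : Punctured (A × B) → ScaledProj A B) :=
  (AssocBundle.isOpenQuotientMap_mk (E := A × B) (F := PUnit.{1})).comp
    (Homeomorph.prodPUnit (Punctured (A × B))).symm.isOpenQuotientMap

instance : ContinuousSMul ℂˣ (ScaledProj A B) where
  continuous_smul := by
    refine (IsOpenQuotientMap.id.prodMap isOpenQuotientMap_mk).isQuotientMap.continuous_iff.2 ?_
    refine isOpenQuotientMap_mk.continuous.comp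
      (f := fun x : ℂˣ × Punctured (A × B) => sndScale x.1 x.2) ?_
    unfold sndScale
    fun_prop

end ScaledProj

end ScaledProj

section Moduli

variable {l : Matrix (Fin 3) (Fin 3) ℕ} {ζ : Fin 3 → ℝ}

/-- The representation with given scalars on the arrows. -/
def repOfScalars (x : Fin (l 0 1) → ℂ) (y : Fin (l 0 2) → ℂ) (z : Fin (l 1 2) → ℂ) :
    QuiverRep l (fun _ => 1)
  | 0, 1 => fun a => Matrix.of fun _ _ => x a
  | 0, 2 => fun a => Matrix.of fun _ _ => y a
  | 1, 2 => fun a => Matrix.of fun _ _ => z a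
  | _, _ => fun _ => 0

/-- Stable representations in terms of scalars. -/
def stableRepHomeomorph (hl : ∀ i j, j ≤ i → l i j = 0) (h : ζ 0 + ζ 1 + ζ 2 = 0)
    (h1 : 0 < ζ 1) (h2 : 0 < ζ 2) :
    Punctured (Fin (l 0 1) → ℂ) × Punctured ((Fin (l 0 2) → ℂ) × (Fin (l 1 2) → ℂ)) ≃ₜ
      {f : QuiverRep l (fun _ => 1) // IsStableRep ζ f} where
  toFun p := ⟨repOfScalars p.1.1 p.2.1.1 p.2.1.2, (isStableRep_iff hl h h1 h2 _).2 ⟨p.1.2, p.2.2⟩⟩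
  invFun f := (⟨fun a => f.1 0 1 a 0 0, ((isStableRep_iff hl h h1 h2 _).1 f.2).1⟩,
    ⟨(fun a => f.1 0 2 a 0 0, fun a => f.1 1 2 a 0 0),
      ((isStableRep_iff hl h h1 h2 _).1 f.2).2⟩)
  left_inv p := rfl
  right_inv f := by
    refine Subtype.ext (funext fun i => funext fun j => funext fun a => ?_)
    ext p q
    rw [Subsingleton.elim p 0, Subsingleton.elim q 0]
    by_cases hij : j ≤ i
    · exact (Fin.cast (hl i j hij) a).elim0
    · fin_cases i <;> fin_cases j <;> first | rfl | exact absurd (by decide) hij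
  continuous_toFun := by
    refine Continuous.subtype_mk (continuous_pi fun i => continuous_pi fun j =>
      continuous_pi fun a => continuous_matrix fun p q => ?_) _
    have hx : Continuous fun p : Punctured (Fin (l 0 1) → ℂ) ×
        Punctured ((Fin (l 0 2) → ℂ) × (Fin (l 1 2) → ℂ)) => p.1.1 := by fun_prop
    have hy : Continuous fun p : Punctured (Fin (l 0 1) → ℂ) ×
        Punctured ((Fin (l 0 2) → ℂ) × (Fin (l 1 2) → ℂ)) => p.2.1 := by fun_prop
    by_cases hij : j ≤ i
    · exact (Fin.cast (hl i j hij) a).elim0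
    · fin_cases i <;> fin_cases j <;> first | exact absurd (by decide) hij | skip
      · exact (continuous_apply a).comp hx
      · exact (continuous_apply a).comp hy.fst
      · exact (continuous_apply a).comp hy.snd
  continuous_invFun := by
    have hc : ∀ i j, Continuous fun f : {f : QuiverRep l (fun _ => 1) // IsStableRep ζ f} =>
        fun a => f.1 i j a 0 0 := fun i j => continuous_pi fun a =>
      (continuous_apply_apply 0 0).comp ((continuous_apply a).comp
        ((continuous_apply_apply i j).comp continuous_subtype_val))
    exact ((hc 0 1).subtype_mk _).prodMk (((hc 0 2).prodMk (hc 1 2)).subtype_mk _)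

lemma nonempty_homeomorph_stableModuli (hl : ∀ i j, j ≤ i → l i j = 0)
    (h : ζ 0 + ζ 1 + ζ 2 = 0) (h1 : 0 < ζ 1) (h2 : 0 < ζ 2) :
    Nonempty (AssocBundle (Fin (l 0 1) → ℂ) (ScaledProj (Fin (l 0 2) → ℂ) (Fin (l 1 2) → ℂ)) ≃ₜ
      StableModuli l (fun _ => 1) ζ) := by
  refine nonempty_homeomorph_of_isQuotientMap
    (AssocBundle.isOpenQuotientMap_mk.comp
      (IsOpenQuotientMap.id.prodMap ScaledProj.isOpenQuotientMap_mk)).isQuotientMap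
    (isQuotientMap_quot_mk.comp (stableRepHomeomorph hl h h1 h2).isQuotientMap) ?_
  rintro ⟨x, y⟩ ⟨x', y'⟩
  refine AssocBundle.mk_eq_mk.trans (Iff.trans ?_
    ((Quotient.eq (r := stableRepSetoid l _ ζ)).trans stableRepSetoid_one_iff).symm)
  constructor
  · rintro ⟨c, hx, hy⟩
    obtain ⟨b, hb⟩ := ScaledProj.mk_eq_mk.1 ((ScaledProj.smul_mk c y).symm.trans hy.symm)
    have hb1 := congrArg Prod.fst hb
    have hb2 := congrArg Prod.snd hb
    refine ⟨![1, c⁻¹, b⁻¹], fun i j a => ?_⟩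
    by_cases hij : j ≤ i
    · exact (Fin.cast (hl i j hij) a).elim0
    · fin_cases i <;> fin_cases j <;> first | exact absurd (by decide) hij | skip
      · change x'.1 a = 1 * x.1 a * _
        have : x'.1 a = c * x.1 a := congrFun hx a
        simp [this, mul_comm]
      · change y'.1.1 a = 1 * y.1.1 a * _
        have : y'.1.1 a = b * y.1.1 a := congrFun hb1 a
        simp [this, mul_comm]
      · change y'.1.2 a = (c⁻¹ : ℂˣ) * y.1.2 a * _
        have : y'.1.2 a = b * ((c⁻¹ : ℂˣ) * y.1.2 a) := congrFun hb2 a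
        simp [this, mul_comm]
  · rintro ⟨c, hc⟩
    refine ⟨c 0 * (c 1)⁻¹, funext fun a => ?_, Eq.symm (ScaledProj.mk_eq_mk.2
      ⟨c 0 * (c 2)⁻¹, Prod.ext (funext fun a => ?_) (funext fun a => ?_)⟩)⟩
    · have : x'.1 a = c 0 * x.1 a * ((c 1)⁻¹ : ℂˣ) := hc 0 1 a
      change x'.1 a = (c 0 * (c 1)⁻¹ : ℂˣ) * x.1 a
      rw [this, Units.val_mul]
      ring
    · have : y'.1.1 a = c 0 * y.1.1 a * ((c 2)⁻¹ : ℂˣ) := hc 0 2 a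
      change y'.1.1 a = (c 0 * (c 2)⁻¹ : ℂˣ) * y.1.1 a
      rw [this, Units.val_mul]
      ring
    · have : y'.1.2 a = c 1 * y.1.2 a * ((c 2)⁻¹ : ℂˣ) := hc 1 2 a
      change y'.1.2 a = (c 0 * (c 2)⁻¹ : ℂˣ) * (((c 0 * (c 1)⁻¹)⁻¹ : ℂˣ) * y.1.2 a)
      rw [this, ← mul_assoc, ← Units.val_mul, show c 0 * (c 2)⁻¹ * (c 0 * (c 1)⁻¹)⁻¹ =
        c 1 * (c 2)⁻¹ by
          rw [mul_inv, inv_inv, mul_mul_mul_comm, mul_inv_cancel, one_mul, mul_comm], Units.val_mul]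
      ring

end Moduli

theorem mainTheorem2
    -- the numbers of arrows `2 → 1`, `3 → 1`, `3 → 2`
    (l₁₂ l₁₃ l₂₃ : ℕ) (hl₁₂ : l₁₂ ≠ 0) (hl₁₃ : l₁₃ ≠ 0) (hl₂₃ : l₂₃ ≠ 0)
    -- intersection numbers, Kähler parameters, and first Chern classes of the summands
    {h : ℕ} (D : Fin h → Fin h → Fin h → ℝ) (t : Fin h → ℝ) (c₁ : Fin 3 → Fin h → ℤ)
    (hc₁ : ∑ v, c₁ v = 0)
    (hprop : ∃ r : ℝ, 0 < r ∧ ∀ a, (c₁ 1 a : ℝ) = r * (c₁ 2 a : ℝ))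
    -- the FI parameters are, up to an overall positive factor, the slopes of the summands
    (ζ : Fin 3 → ℝ) (κ : ℝ) (hκ : 0 < κ)
    (hζ : ∀ v, ζ v = κ * lineBundleSlope D t (c₁ v)) :
    ∃ P : Polynomial ℤ,
      IsPoincarePolynomial
        (StableModuli !![0, l₁₂, l₁₃; 0, 0, l₂₃; 0, 0, 0] (fun _ : Fin 3 => 1) ζ) P ∧
      ((ζ 0 < 0 ∧ 0 < ζ 2) →
        P * (Polynomial.X ^ 2 - 1) ^ 2 =
          (Polynomial.X ^ (2 * (l₁₃ + l₂₃)) - 1) * (Polynomial.X ^ (2 * l₁₂) - 1)) ∧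
      (¬(ζ 0 < 0 ∧ 0 < ζ 2) → P = 0) := by
  have hsum : ζ 0 + ζ 1 + ζ 2 = 0 := by
    have h0 : ∀ a, (c₁ 0 a : ℝ) + c₁ 1 a + c₁ 2 a = 0 := fun a => by
      have := congrFun hc₁ a
      rw [Fin.sum_univ_three] at this
      exact_mod_cast this
    simp only [hζ, lineBundleSlope, ← mul_add, ← Finset.sum_add_distrib]
    refine mul_eq_zero_of_right _ (Finset.sum_eq_zero fun i _ => Finset.sum_eq_zero fun j _ =>
      Finset.sum_eq_zero fun k _ => ?_)
    linear_combination D i j k * t j * t k * h0 i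
  obtain ⟨r, hr, hr'⟩ := hprop
  have hζ1 : ζ 1 = r * ζ 2 := by
    rw [hζ, hζ, mul_left_comm]
    congr 1
    simp only [lineBundleSlope, Finset.mul_sum, hr']
    exact Finset.sum_congr rfl fun i _ => Finset.sum_congr rfl fun j _ =>
      Finset.sum_congr rfl fun k _ => by ring
  have hl : ∀ i j : Fin 3, j ≤ i →
      (!![0, l₁₂, l₁₃; 0, 0, l₂₃; 0, 0, 0] : Matrix (Fin 3) (Fin 3) ℕ) i j = 0 := by
    intro i j hij
    fin_cases i <;> fin_cases j <;> first | rfl | exact absurd hij (by decide)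
  by_cases hs : ζ 0 < 0 ∧ 0 < ζ 2
  · obtain ⟨e⟩ := nonempty_homeomorph_stableModuli hl hsum (hζ1 ▸ mul_pos hr hs.2) hs.2
    have h1 : IsPoincarePolynomial (ScaledProj (Fin l₁₃ → ℂ) (Fin l₂₃ → ℂ)) _ :=
      AssocBundle.isPoincarePolynomial (isPoincarePolynomial_of_unique (X := PUnit.{1}))
        (fun k => by simp [Polynomial.coeff_one]) (l₁₃ + l₂₃) ((Fin l₁₃ → ℂ) × (Fin l₂₃ → ℂ)) (by simp)
    have h2 := AssocBundle.isPoincarePolynomial (F := ScaledProj (Fin l₁₃ → ℂ) (Fin l₂₃ → ℂ)) h1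
      (AssocBundle.coeff_sum_pow_mul_odd _ fun k => by simp [Polynomial.coeff_one]) l₁₂ (Fin l₁₂ → ℂ) (by simp)
    refine ⟨_, IsPoincarePolynomial.of_homeomorph h2 e, fun _ => ?_, fun h' => absurd hs h'⟩
    have hg : ∀ n : ℕ, (∑ i ∈ Finset.range n, Polynomial.X ^ (2 * i) : Polynomial ℤ) * (Polynomial.X ^ 2 - 1) =
        Polynomial.X ^ (2 * n) - 1 := fun n => by
      simpa only [pow_mul] using geom_sum_mul (Polynomial.X ^ 2 : Polynomial ℤ) n
    rw [← hg, ← hg]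
    ring
  · refine ⟨0, ?_, fun h' => absurd h' hs, fun _ => rfl⟩
    have : IsEmpty (StableModuli !![0, l₁₂, l₁₃; 0, 0, l₂₃; 0, 0, 0] (fun _ : Fin 3 => 1) ζ) := by
      refine ⟨fun x => ?_⟩
      obtain ⟨f, -⟩ := Quotient.exists_rep x
      have h0 : ζ 0 < 0 := f.2.neg_of_forall_eq_zero hsum fun i a =>
        (Fin.cast (hl i 0 (Fin.zero_le i)) a).elim0
      refine hs ⟨h0, pos_of_mul_pos_right (a := 1 + r) ?_ (by linarith)⟩
      linarith
    exact isPoincarePolynomial_of_isEmpty
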